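/- **Setting.** A microtransit network design instance consists of finite sets of stations, reference lines $\ell$, departure times $t\in\mathcal T_\ell$, requests $p$, and scenarios $s$ with probabilities $\pi_s$. Line $\ell$ has $I_\ell\ge 2$ distinct ordered checkpoints, all lines ending at the same final checkpoint; trip $(\ell,t)$ is scheduled at them at strictly increasing times $T_{\ell t}(\cdot)\ge0$; the vehicle capacity is $C_\ell$, and up to $K$ consecutive checkpoints may be skipped. Vehicles may visit the stations within a deviation limit of the line; moves $i\to j$ allowed on the line have travel time $tt_{ij}>0$. Request $p$ has $D_{ps}\in\mathbb N$ passengers in scenario $s$. It is compatible with trip $(\ell,t)$ if the trip's final scheduled time $T^{end}_{\ell t}$ is within a tolerance of the requested drop-off time; $\tau^{late}_{\ell tp}$ and $\tau^{early}_{\ell tp}$ are the positive and negative parts of the difference. If compatible, it may be picked up at a station $i$ near the line with walking time $\tau^{walk}_{ip}\le\Omega$ (write $i\in N_p$), at a time in $[t^0_{\ell tp}+\tau^{walk}_{ip},\,t^0_{\ell tp}+\tau^{walk}_{ip}+\Psi]$. A pickup at $i$ at time $\theta$ costs, per passenger, $$\lambda\tau^{walk}_{ip}+\mu(\theta-\tau^{req}_p-\tau^{walk}_{ip})+\sigma\frac{T^{end}_{\ell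 t}-\theta}{\tau^{dir}_p}+\delta\frac{\tau^{late}_{\ell tp}}{\tau^{dir}_p}+\frac\delta2\frac{\tau^{early}_{\ell tp}}{\tau^{dir}_p}-M ,$$ where $\tau_p^{dir}>0$ and $\lambda,\mu,\sigma,\delta\ge0$. The first stage chooses binary trip selections $x_{\ell t}$ and binary assignments $z_{\ell pst}$ subject to the fleet-size, packing and target-load constraints, at cost $\sum h_\ell x_{\ell t}$. Each trip $(\ell,t)$ and scenario $s$ has a second-stage problem, in one of two formulations. *Subpath formulation.* A subpath goes from a checkpoint $u$ at time $T_{\ell t}(u)$ to a later checkpoint $v$ at time $T_{\ell t}(v)$, skipping at most $K$ checkpoints, through a timed sequence of near stations that are not checkpoints of the line, with consecutive moves allowed and consecutive times leaving at least the travel time (idling is allowed). It picks up a set of requests with at most $C_\ell$ passengers at acceptable stops and times; passengers at a checkpoint belong to the subpath that departs from it, except at the end of the line. The nodes of the load-expanded network are the checkpoint–load pairs with loads $0,\dots,C_\ell$, and a sink. Each subpath gives an arc from $(u,c)$ to $(v,c')$ whenever $c'-c$ is its number of passengers; zero-cost arcs lead from the final checkpoint to the sink. The variables are $y_a\in\{0,1\}$,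 finitely many of them nonzero. The constraints are flow balance with $x_{\ell t}$ units sent from (first checkpoint, load $0$) to the sink, and $\sum_{a:\,a\text{ serves }p}y_a\le z_{\ell pst}$ for compatible $p$. The objective $\sum_a g_ay_a$ adds $D_{ps}$ times the above cost over the pickups. *Compact formulation.* The variables are binary $v_i$ (checkpoint $i$ is visited), $y_{ij}$ (the vehicle travels $i\to j$), $w_{pi}$ (pickup of $p$ at $i$), and $t^{stop}_i,t^{pickup}_p\ge0$. With sums over allowed moves and big-M constants $M^{stop},M^T,M^y$, the constraints are: station flow balance of $x_{\ell t}$ units from the first to the last checkpoint; $t^{stop}_j\ge t^{stop}_i+tt_{ij}-M^{stop}(1-y_{ij})$; $\sum_{i\in N_p}w_{pi}\le z_{\ell pst}$ for compatible $p$; $\sum_p\sum_{i\in N_p}D_{ps}w_{pi}\le C_\ell x_{\ell t}$; $t^{pickup}_p\ge t^{stop}_i-M^{stop}(1-w_{pi})$; $w_{pi}\le\sum_jy_{ij}+\sum_jy_{ji}$ for $i\in N_p$; $t^0_{\ell tp}+\tau^{walk}_{ip}-M^{stop}(1-w_{pi})\le t^{stop}_i\le t^0_{\ell tp}+\tau^{walk}_{ip}+\Psi+M^{stop}(1-w_{pi})$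 for $i\in N_p$; $|t^{stop}_i-T_{\ell t}(i)|\le M^T(1-v_i)$ for checkpoints $i$; $t^{stop}_i\le M^y(\sum_jy_{ij}+\sum_jy_{ji})$; for checkpoints $i$ and allowed moves, $y_{ij}\le v_i$, $y_{ji}\le v_i$, and $v_i\le\sum_jy_{ij}+\sum_jy_{ji}$; and $v$ sums to at least $x_{\ell t}$ over any $K+1$ consecutive checkpoints. The objective is $$\sum_pD_{ps}\Big(\sum_{i\in N_p}\Big[\lambda\tau^{walk}_{ip}-\mu(\tau^{req}_p+\tau^{walk}_{ip})+\frac{\sigma T^{end}_{\ell t}+\delta\tau^{late}_{\ell tp}+\frac\delta2\tau^{early}_{\ell tp}}{\tau^{dir}_p}-M\Big]w_{pi}+\Big(\mu-\frac{\sigma}{\tau^{dir}_p}\Big)t^{pickup}_p\Big).$$ Call a (possibly fractional) subpath solution *simple* if every vehicle traveling along arcs it uses visits each station at most once. **Proposition.** For every instance there is a constant $B$ such that, whenever $M^{stop},M^T,M^y\ge B$, the following hold. 1. For every trip, scenario, and binary $x,z$: for every optimal solution of the compact formulation there is a simple feasible solution of the subpath formulation with the same objective value; and for every simple feasible (in particular,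 every simple optimal) solution of the subpath formulation there is a feasible solution of the compact formulation with the same objective value. If the compact problem is bounded below, then a number is its minimum if and only if it is the minimum over the simple feasible subpath solutions; if some optimal solution of the subpath formulation is simple, then its value is the minimum of the compact problem. 2. If the full two-stage problem with the compact formulation (objective $\sum_{\ell,t}(h_\ell x_{\ell t}+\sum_s\pi_s\cdot\text{second-stage objective})$) is bounded below, then a number is its minimum if and only if it is the minimum of the two-stage problem with the subpath formulation over simple solutions; if an optimal solution of the two-stage subpath problem is simple, its value is the minimum of the two-stage compact problem. All these compact problems are bounded below if $\sigma\le\mu\tau^{dir}_p$ for all $p$. 3. The second-stage linear relaxation of the subpath formulation is at least as tight: for every trip, scenario, and all $x,z$ with values in $[0,1]$, every simple feasible solution of the subpath relaxation has the same objective value as some feasible solution of the compact relaxation. Moreover, the tightening can be strict: for some instance, trip and scenario, with $x=1$ and $z\equiv1$, for all sufficiently large big-M constants both relaxations attain their minima and the minimum of the compact relaxation is strictly smaller than that of the subpath relaxation. -/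

import Mathlib

open scoped BigOperators

universe u₁ u₂ u₃ u₄

/-- An instance of the microtransit network design problem (routing version): a road network with
its stations, candidate reference lines with their timetables, passenger requests, and demand
scenarios. -/
structure MiND (Station : Type u₁) (Line : Type u₂) (Request : Type u₃) (Scenario : Type u₄)
    [Fintype Scenario] where
  /-- number of checkpoints of a line -/
  numCk : Line → ℕ
  two_le_numCk : ∀ l, 2 ≤ numCk l
  /-- the ordered checkpoints of a line (indices start at `0`) -/
  ck : (l : Line) → Fin (numCk l) → Station
  ck_injective : ∀ l, Function.Injective (ck l)
  /-- the common final checkpoint of all lines -/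
  dest : Station
  ck_last : ∀ l (k : Fin (numCk l)), (k : ℕ) + 1 = numCk l → ck l k = dest
  /-- candidate departure times of a line -/
  times : Line → Finset ℝ
  /-- `sched l t k` is the scheduled time of reference trip `(l, t)` at the `k`-th checkpoint -/
  sched : (l : Line) → ℝ → Fin (numCk l) → ℝ
  sched_strictMono : ∀ l, ∀ t ∈ times l, StrictMono (sched l t)
  sched_nonneg : ∀ l, ∀ t ∈ times l, ∀ k, 0 ≤ sched l t k
  /-- distance of a station to a reference line, and the largest admissible deviation -/
  lineDist : Line → Station → ℝ
  devMax : ℝ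
  ck_near : ∀ l k, lineDist l (ck l k) ≤ devMax
  /-- `next l i j`: on line `l`, location `j` can be visited immediately after location `i` -/
  next : Line → Station → Station → Prop
  /-- travel times -/
  tt : Station → Station → ℝ
  tt_pos : ∀ l i j, next l i j → 0 < tt i j
  /-- number of consecutive checkpoints that may be skipped -/
  K : ℕ
  /-- vehicle capacities -/
  cap : Line → ℕ
  /-- cost to operate one trip of a line -/
  opCost : Line → ℝ
  /-- fleet size -/
  fleet : ℕ
  /-- target load factor -/
  kappa : ℝ
  /-- scenario probabilities -/
  prob : Scenario → ℝ
  prob_nonneg : ∀ s, 0 ≤ prob s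
  prob_sum : ∑ s, prob s = 1
  /-- number of passengers of a request in a scenario -/
  demand : Request → Scenario → ℕ
  /-- requested drop-off time, and its tolerance -/
  tDrop : Request → ℝ
  alpha : ℝ
  /-- direct trip time of a request -/
  tauDir : Request → ℝ
  tauDir_pos : ∀ p, 0 < tauDir p
  /-- `walk i p` is the walking time from the origin of `p` to location `i` -/
  walk : Station → Request → ℝ
  /-- time at which request `p` is ready: waiting time is counted from `tauReq p + walk i p` -/
  tauReq : Request → ℝ
  /-- `t0 l t p` is the planned departure time of `p` if it is served by trip `(l, t)` -/
  t0 : Line → ℝ → Request → ℝ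
  /-- walking limit and waiting limit -/
  walkMax : ℝ
  waitMax : ℝ
  /-- weights of walking time, waiting time, detour, and delay -/
  lam : ℝ
  mu : ℝ
  sigma : ℝ
  delta : ℝ
  lam_nonneg : 0 ≤ lam
  mu_nonneg : 0 ≤ mu
  sigma_nonneg : 0 ≤ sigma
  delta_nonneg : 0 ≤ delta
  /-- reward of a pickup -/
  reward : ℝ

/-- A real number that is `0` or `1`. -/
def IsBinary (r : ℝ) : Prop := r = 0 ∨ r = 1

/-- The big-M parameters of the compact formulation. -/
structure BigM where
  mTravel : ℝ
  mSched : ℝ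
  mVisit : ℝ

/-- All three big-M parameters are at least `B`. -/
def BigM.AtLeast (M : BigM) (B : ℝ) : Prop := B ≤ M.mTravel ∧ B ≤ M.mSched ∧ B ≤ M.mVisit

namespace MiND

noncomputable section

open Classical

variable {Station : Type u₁} {Line : Type u₂} {Request : Type u₃} {Scenario : Type u₄}
  [Fintype Scenario]

/-! ### Reference trips -/

/-- The first checkpoint index of a line. -/
def firstCk (N : MiND Station Line Request Scenario) (l : Line) : Fin (N.numCk l) :=
  ⟨0, lt_of_lt_of_le Nat.zero_lt_two (N.two_le_numCk l)⟩

/-- The last checkpoint index of a line. -/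
def lastCk (N : MiND Station Line Request Scenario) (l : Line) : Fin (N.numCk l) :=
  ⟨N.numCk l - 1, Nat.sub_lt (lt_of_lt_of_le Nat.zero_lt_two (N.two_le_numCk l)) Nat.zero_lt_one⟩

/-- Reference trips: a line with one of its departure times. -/
abbrev Trip (N : MiND Station Line Request Scenario) : Type u₂ :=
  (l : Line) × {t : ℝ // t ∈ N.times l}

/-- Checkpoint indices of a trip. -/
abbrev Ck (N : MiND Station Line Request Scenario) (τ : N.Trip) : Type := Fin (N.numCk τ.1)

/-- Scheduled time of a trip at a checkpoint. -/
def T (N : MiND Station Line Request Scenario) (τ : N.Trip) (k : N.Ck τ) : ℝ :=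
  N.sched τ.1 τ.2.1 k

/-- Scheduled time of a trip at the final checkpoint: the drop-off time. -/
def Tend (N : MiND Station Line Request Scenario) (τ : N.Trip) : ℝ := N.T τ (N.lastCk τ.1)

/-- Trip `τ` can serve request `p` within the tolerance around the requested drop-off time. -/
def Compatible (N : MiND Station Line Request Scenario) (τ : N.Trip) (p : Request) : Prop :=
  |N.Tend τ - N.tDrop p| ≤ N.alpha

/-- Station `i` lies within the admissible deviation of line `l`. -/
def Near (N : MiND Station Line Request Scenario) (l : Line) (i : Station) : Prop :=
  N.lineDist l i ≤ N.devMax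

/-- `i` is a possible pickup location of `p` on trip `τ`. -/
def IsPickup (N : MiND Station Line Request Scenario) (τ : N.Trip) (p : Request) (i : Station) :
    Prop :=
  N.Compatible τ p ∧ N.Near τ.1 i ∧ N.walk i p ≤ N.walkMax

/-- Earliest acceptable time of a pickup of `p` by trip `τ` at `i`. -/
def earliest (N : MiND Station Line Request Scenario) (τ : N.Trip) (p : Request) (i : Station) :
    ℝ :=
  N.t0 τ.1 τ.2.1 p + N.walk i p

/-- Latest acceptable time of a pickup of `p` by trip `τ` at `i`. -/
def latest (N : MiND Station Line Request Scenario) (τ : N.Trip) (p : Request) (i : Station) :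
    ℝ :=
  N.t0 τ.1 τ.2.1 p + N.walk i p + N.waitMax

/-- Delay of `p` at the destination when it takes trip `τ`. -/
def late (N : MiND Station Line Request Scenario) (τ : N.Trip) (p : Request) : ℝ :=
  max 0 (N.Tend τ - N.tDrop p)

/-- Earliness of `p` at the destination when it takes trip `τ`. -/
def early (N : MiND Station Line Request Scenario) (τ : N.Trip) (p : Request) : ℝ :=
  max 0 (N.tDrop p - N.Tend τ)

/-! ### First stage -/

/-- The first-stage constraints on trip selections `x` and passenger assignments `z`:
fleet size, packing, target load, and (first-stage) capacity; `x` and `z` are binary. -/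
structure FirstStage [Fintype Line] [Fintype Request] (N : MiND Station Line Request Scenario)
    (x : N.Trip → ℝ) (z : N.Trip → Request → Scenario → ℝ) : Prop where
  x_binary : ∀ τ, IsBinary (x τ)
  z_binary : ∀ τ p s, IsBinary (z τ p s)
  budget : ∀ l₀, ∀ t ∈ N.times l₀,
    ∑ τ : N.Trip, (if τ.2.1 ≤ t ∧ t ≤ τ.2.1 + (N.Tend τ - N.T τ (N.firstCk τ.1))
      then x τ else 0) ≤ N.fleet
  assign : ∀ p s, ∑ τ : N.Trip, (if N.Compatible τ p then z τ p s else 0) ≤ 1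
  load_ge : ∀ τ s, (1 - N.kappa) * N.cap τ.1 * x τ ≤
    ∑ p, (if N.Compatible τ p then N.demand p s * z τ p s else 0)
  load_le : ∀ τ s, ∑ p, (if N.Compatible τ p then N.demand p s * z τ p s else 0) ≤
    (1 + N.kappa) * N.cap τ.1 * x τ

/-! ### Subpaths and the load-expanded network -/

/-- A subpath of trip `τ` in scenario `s`: it leaves checkpoint `u` at its scheduled time, reaches
checkpoint `v` at its scheduled time, skips at most `K` checkpoints, and records its route as the
list of its location-time pairs together with the location-time pair at which each served request is picked up.
Successive times leave room for the travel time in between (the vehicle may idle), so that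
the travel time does not exceed the scheduled time between `u` and `v`. Passengers at
a checkpoint are picked up by the subpath that departs from it, except at the end of the line. -/
structure Subpath [Fintype Request] (N : MiND Station Line Request Scenario) (τ : N.Trip)
    (s : Scenario) where
  u : N.Ck τ
  v : N.Ck τ
  u_lt_v : u < v
  skip : (v : ℕ) ≤ u + N.K + 1
  stops : List (Station × ℝ)
  stops_head : stops.head? = some (N.ck τ.1 u, N.T τ u)
  stops_last : stops.getLast? = some (N.ck τ.1 v, N.T τ v)
  stops_chain : stops.IsChain fun a b => N.next τ.1 a.1 b.1 ∧ a.2 + N.tt a.1 b.1 ≤ b.2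
  stops_near : ∀ a ∈ stops, N.Near τ.1 a.1
  inner_not_ck : ∀ a ∈ stops.tail.dropLast, ∀ k, a.1 ≠ N.ck τ.1 k
  pickup : Request → Option (Station × ℝ)
  pickup_stop : ∀ p a, pickup p = some a → a ∈ stops
  pickup_location : ∀ p a, pickup p = some a → N.IsPickup τ p a.1
  pickup_time : ∀ p a, pickup p = some a → N.earliest τ p a.1 ≤ a.2 ∧ a.2 ≤ N.latest τ p a.1
  pickup_end : ∀ p a, pickup p = some a → a.1 = N.ck τ.1 v → v = N.lastCk τ.1
  load_le : ∑ p, (if (pickup p).isSome then N.demand p s else 0) ≤ N.cap τ.1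

/-- Number of passengers that a subpath picks up. -/
def Subpath.load [Fintype Request] {N : MiND Station Line Request Scenario} {τ : N.Trip}
    {s : Scenario} (r : N.Subpath τ s) : ℕ :=
  ∑ p, (if (r.pickup p).isSome then N.demand p s else 0)

/-- Contribution to the cost of one passenger of request `p`, picked up by trip `τ` at location
`i` at time `t`. -/
def unitCost (N : MiND Station Line Request Scenario) (τ : N.Trip) (p : Request) (i : Station)
    (t : ℝ) : ℝ :=
  N.lam * N.walk i p + N.mu * (t - N.tauReq p - N.walk i p)
    + N.sigma * ((N.Tend τ - t) / N.tauDir p)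
    + N.delta * (N.late τ p / N.tauDir p) + N.delta / 2 * (N.early τ p / N.tauDir p) - N.reward

/-- Cost of a subpath. -/
def Subpath.cost [Fintype Request] {N : MiND Station Line Request Scenario} {τ : N.Trip}
    {s : Scenario} (r : N.Subpath τ s) : ℝ :=
  ∑ p, (match r.pickup p with
    | none => 0
    | some a => N.demand p s * N.unitCost τ p a.1 a.2)

/-- Nodes of the load-expanded network: checkpoint-load pairs, and the sink. -/
inductive Node (N : MiND Station Line Request Scenario) (τ : N.Trip) : Type
  | pair (k : N.Ck τ) (c : Fin (N.cap τ.1 + 1))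
  | sink

/-- The node at which a trip starts: first checkpoint, no load. -/
def source (N : MiND Station Line Request Scenario) (τ : N.Trip) : N.Node τ :=
  .pair (N.firstCk τ.1) 0

/-- Arcs of the load-expanded network: one traveling arc for each subpath and each pair of loads
that differ by the load of the subpath, and terminating arcs from the final checkpoint. -/
inductive Arc [Fintype Request] (N : MiND Station Line Request Scenario) (τ : N.Trip)
    (s : Scenario) : Type (max u₁ u₃)
  | travel (r : N.Subpath τ s) (c c' : Fin (N.cap τ.1 + 1)) (h : (c' : ℕ) = c + r.load)
  | terminate (c : Fin (N.cap τ.1 + 1))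

namespace Arc

variable [Fintype Request] {N : MiND Station Line Request Scenario} {τ : N.Trip} {s : Scenario}

/-- Tail of an arc. -/
def start : N.Arc τ s → N.Node τ
  | travel r c _ _ => .pair r.u c
  | terminate c => .pair (N.lastCk τ.1) c

/-- Head of an arc. -/
def finish : N.Arc τ s → N.Node τ
  | travel r _ c' _ => .pair r.v c'
  | terminate _ => .sink

/-- Cost of an arc. -/
def cost : N.Arc τ s → ℝ
  | travel r _ _ _ => r.cost
  | terminate _ => 0

/-- Request `p` is picked up along the arc. -/
def Serves (p : Request) : N.Arc τ s → Prop
  | travel r _ _ _ => (r.pickup p).isSome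
  | terminate _ => False

/-- The locations visited along the arc, in order. -/
def stations : N.Arc τ s → List Station
  | travel r _ _ _ => r.stops.map Prod.fst
  | terminate _ => []

/-- The locations visited strictly between the two end checkpoints of the arc. -/
def inner (a : N.Arc τ s) : List Station := a.stations.tail.dropLast

end Arc

/-! ### Second stage: subpath formulation

The variables are indexed by the arcs. Since visiting times are real numbers there are infinitely many
arcs, and a solution selects finitely many. -/

section Sub

variable [Fintype Request] (N : MiND Station Line Request Scenario) (τ : N.Trip) (s : Scenario)

/-- The linear constraints: flow balance in the load-expanded network, and service only of
assigned requests. -/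
structure SubLinear (x : ℝ) (z : Request → ℝ) (y : N.Arc τ s →₀ ℝ) : Prop where
  flow : ∀ n : N.Node τ,
    (y.sum fun a r => if a.start = n then r else 0)
      - (y.sum fun a r => if a.finish = n then r else 0)
      = if n = N.source τ then x else if n = .sink then -x else 0
  serve : ∀ p, N.Compatible τ p → (y.sum fun a r => if a.Serves p then r else 0) ≤ z p

/-- Feasible solutions of the subpath formulation. -/
def SubFeasible (x : ℝ) (z : Request → ℝ) (y : N.Arc τ s →₀ ℝ) : Prop :=
  N.SubLinear τ s x z y ∧ ∀ a, IsBinary (y a)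

/-- Feasible solutions of the linear relaxation of the subpath formulation. -/
def SubRelaxed (x : ℝ) (z : Request → ℝ) (y : N.Arc τ s →₀ ℝ) : Prop :=
  N.SubLinear τ s x z y ∧ ∀ a, 0 ≤ y a ∧ y a ≤ 1

/-- Objective of the subpath formulation. -/
def subObj (y : N.Arc τ s →₀ ℝ) : ℝ := y.sum fun a r => a.cost * r

variable {N τ s} in
/-- Arc `b` directly follows arc `a`, and both are used by `y`. -/
def Follows (y : N.Arc τ s →₀ ℝ) (a b : N.Arc τ s) : Prop :=
  y a ≠ 0 ∧ y b ≠ 0 ∧ a.finish = b.start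

variable {N τ s} in
/-- A vehicle that travels along arcs used by `y` visits every location at most once: no used arc
visits a location twice, and successive arcs do not share locations (other than the checkpoint at
which one ends and the next one starts). -/
def VisitsOnce (y : N.Arc τ s →₀ ℝ) : Prop :=
  (∀ a, y a ≠ 0 → a.stations.Nodup) ∧
    ∀ a b, Relation.TransGen (Follows y) a b → List.Disjoint a.inner b.inner

/-- Objective values of the feasible solutions. -/
def subValues (x : ℝ) (z : Request → ℝ) : Set ℝ :=
  {m | ∃ y, N.SubFeasible τ s x z y ∧ m = N.subObj τ s y}

/-- Objective values of the feasible solutions that visit each location at most once. -/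
def subValuesOnce (x : ℝ) (z : Request → ℝ) : Set ℝ :=
  {m | ∃ y, N.SubFeasible τ s x z y ∧ VisitsOnce y ∧ m = N.subObj τ s y}

/-- Objective values of the linear relaxation. -/
def subRelaxedValues (x : ℝ) (z : Request → ℝ) : Set ℝ :=
  {m | ∃ y, N.SubRelaxed τ s x z y ∧ m = N.subObj τ s y}

end Sub

/-! ### Second stage: compact formulation -/

/-- Variables of the compact formulation, for one trip and one scenario. -/
structure CompactVars (N : MiND Station Line Request Scenario) (τ : N.Trip) where
  /-- visits to the checkpoints -/
  v : N.Ck τ → ℝ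
  /-- travel from one location to another -/
  y : Station → Station → ℝ
  /-- pickups of requests at locations -/
  w : Request → Station → ℝ
  visitTime : Station → ℝ
  pickTime : Request → ℝ

section Compact

variable [Fintype Station] [Fintype Request] (N : MiND Station Line Request Scenario)
  (τ : N.Trip) (s : Scenario)

/-- The locations that can be visited immediately after location `i`. -/
def succs (l : Line) (i : Station) : Finset Station :=
  Finset.univ.filter fun j => N.Near l j ∧ N.next l i j

/-- The locations that can be visited immediately before location `i`. -/
def preds (l : Line) (i : Station) : Finset Station :=
  Finset.univ.filter fun j => N.Near l j ∧ N.next l j i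

/-- The possible pickup locations of request `p`. -/
def pickupSet (p : Request) : Finset Station := Finset.univ.filter fun i => N.IsPickup τ p i

variable {N τ} in
/-- Travel out of location `i`. -/
def CompactVars.out (c : N.CompactVars τ) (i : Station) : ℝ := ∑ j ∈ N.succs τ.1 i, c.y i j

variable {N τ} in
/-- Travel into location `i`. -/
def CompactVars.inn (c : N.CompactVars τ) (i : Station) : ℝ := ∑ j ∈ N.preds τ.1 i, c.y j i

/-- The linear constraints of the compact formulation. -/
structure CompactLinear (M : BigM) (x : ℝ) (z : Request → ℝ) (c : N.CompactVars τ) : Prop where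
  /-- flow balance -/
  flow : ∀ i, N.Near τ.1 i → c.out i - c.inn i =
    if i = N.ck τ.1 (N.firstCk τ.1) then x else if i = N.ck τ.1 (N.lastCk τ.1) then -x else 0
  /-- travel times -/
  travel : ∀ i, N.Near τ.1 i → ∀ j ∈ N.succs τ.1 i,
    c.visitTime i + N.tt i j - M.mTravel * (1 - c.y i j) ≤ c.visitTime j
  /-- only assigned requests are served -/
  assigned : ∀ p, N.Compatible τ p → ∑ i ∈ N.pickupSet τ p, c.w p i ≤ z p
  /-- vehicle capacity -/
  capacity : ∑ p, ∑ i ∈ N.pickupSet τ p, (N.demand p s : ℝ) * c.w p i ≤ N.cap τ.1 * x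
  /-- pickup times -/
  pickAfterVisit : ∀ p i, N.Near τ.1 i → c.visitTime i - M.mTravel * (1 - c.w p i) ≤ c.pickTime p
  /-- pickups occur at visited locations -/
  pickVisited : ∀ p, ∀ i ∈ N.pickupSet τ p, c.w p i ≤ c.out i + c.inn i
  /-- pickups occur no earlier than the request can be at the location after its planned
  departure -/
  pickEarliest : ∀ p, ∀ i ∈ N.pickupSet τ p,
    N.earliest τ p i - M.mTravel * (1 - c.w p i) ≤ c.visitTime i
  /-- pickups occur within the waiting limit -/
  pickLatest : ∀ p, ∀ i ∈ N.pickupSet τ p,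
    c.visitTime i ≤ N.latest τ p i + M.mTravel * (1 - c.w p i)
  /-- visited checkpoints are visited at the scheduled time -/
  sched_ge : ∀ k, N.T τ k - M.mSched * (1 - c.v k) ≤ c.visitTime (N.ck τ.1 k)
  sched_le : ∀ k, c.visitTime (N.ck τ.1 k) ≤ N.T τ k + M.mSched * (1 - c.v k)
  /-- visiting times at locations that are not visited -/
  stopVisited : ∀ i, N.Near τ.1 i → c.visitTime i ≤ M.mVisit * (c.out i + c.inn i)
  /-- a checkpoint counts as visited only if the vehicle travels through it -/
  ckVisited : ∀ k, c.v k ≤ c.out (N.ck τ.1 k) + c.inn (N.ck τ.1 k)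
  /-- a checkpoint counts as visited if the vehicle travels through it -/
  ckOut : ∀ k, ∀ j ∈ N.succs τ.1 (N.ck τ.1 k), c.y (N.ck τ.1 k) j ≤ c.v k
  ckIn : ∀ k, ∀ j ∈ N.preds τ.1 (N.ck τ.1 k), c.y j (N.ck τ.1 k) ≤ c.v k
  /-- at most `K` checkpoints are skipped in a row -/
  skip : ∀ k : N.Ck τ, (k : ℕ) + N.K < N.numCk τ.1 →
    x ≤ ∑ k' : N.Ck τ, (if (k : ℕ) ≤ k' ∧ (k' : ℕ) ≤ k + N.K then c.v k' else 0)
  visitTime_nonneg : ∀ i, 0 ≤ c.visitTime i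
  pickTime_nonneg : ∀ p, 0 ≤ c.pickTime p

/-- Feasible solutions of the compact formulation. -/
def CompactFeasible (M : BigM) (x : ℝ) (z : Request → ℝ) (c : N.CompactVars τ) : Prop :=
  N.CompactLinear τ s M x z c ∧
    (∀ k, IsBinary (c.v k)) ∧ (∀ i j, IsBinary (c.y i j)) ∧ ∀ p i, IsBinary (c.w p i)

/-- Feasible solutions of the linear relaxation of the compact formulation. -/
def CompactRelaxed (M : BigM) (x : ℝ) (z : Request → ℝ) (c : N.CompactVars τ) : Prop :=
  N.CompactLinear τ s M x z c ∧
    (∀ k, 0 ≤ c.v k ∧ c.v k ≤ 1) ∧ (∀ i j, 0 ≤ c.y i j ∧ c.y i j ≤ 1) ∧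
      ∀ p i, 0 ≤ c.w p i ∧ c.w p i ≤ 1

/-- Objective of the compact formulation. -/
def compactObj (c : N.CompactVars τ) : ℝ :=
  ∑ p, (N.demand p s : ℝ) *
    (N.lam * ∑ i ∈ N.pickupSet τ p, N.walk i p * c.w p i
      + N.mu * (c.pickTime p - ∑ i ∈ N.pickupSet τ p, (N.tauReq p + N.walk i p) * c.w p i)
      + N.sigma / N.tauDir p * (N.Tend τ * ∑ i ∈ N.pickupSet τ p, c.w p i - c.pickTime p)
      + (N.delta * (N.late τ p / N.tauDir p) + N.delta / 2 * (N.early τ p / N.tauDir p))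
          * ∑ i ∈ N.pickupSet τ p, c.w p i
      - N.reward * ∑ i ∈ N.pickupSet τ p, c.w p i)

/-- Optimal solutions of the compact formulation. -/
def CompactOptimal (M : BigM) (x : ℝ) (z : Request → ℝ) (c : N.CompactVars τ) : Prop :=
  N.CompactFeasible τ s M x z c ∧
    ∀ c', N.CompactFeasible τ s M x z c' → N.compactObj τ s c ≤ N.compactObj τ s c'

/-- Objective values of the feasible solutions. -/
def compactValues (M : BigM) (x : ℝ) (z : Request → ℝ) : Set ℝ :=
  {m | ∃ c, N.CompactFeasible τ s M x z c ∧ m = N.compactObj τ s c}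

/-- Objective values of the linear relaxation. -/
def compactRelaxedValues (M : BigM) (x : ℝ) (z : Request → ℝ) : Set ℝ :=
  {m | ∃ c, N.CompactRelaxed τ s M x z c ∧ m = N.compactObj τ s c}

end Compact

/-! ### The two-stage models -/

section Full

variable [Fintype Line] [Fintype Request] (N : MiND Station Line Request Scenario)

/-- Objective values of the two-stage problem with the subpath formulation. -/
def fullSubValues : Set ℝ :=
  {m | ∃ (x : N.Trip → ℝ) (z : N.Trip → Request → Scenario → ℝ)
      (y : (τ : N.Trip) → (s : Scenario) → (N.Arc τ s →₀ ℝ)),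
    N.FirstStage x z ∧ (∀ τ s, N.SubFeasible τ s (x τ) (fun p => z τ p s) (y τ s)) ∧
    m = ∑ τ, (N.opCost τ.1 * x τ + ∑ s, N.prob s * N.subObj τ s (y τ s))}

/-- Objective values of the two-stage problem with the subpath formulation, over solutions under
which each trip visits each location at most once in each scenario. -/
def fullSubValuesOnce : Set ℝ :=
  {m | ∃ (x : N.Trip → ℝ) (z : N.Trip → Request → Scenario → ℝ)
      (y : (τ : N.Trip) → (s : Scenario) → (N.Arc τ s →₀ ℝ)),
    N.FirstStage x z ∧ (∀ τ s, N.SubFeasible τ s (x τ) (fun p => z τ p s) (y τ s)) ∧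
    (∀ τ s, VisitsOnce (y τ s)) ∧
    m = ∑ τ, (N.opCost τ.1 * x τ + ∑ s, N.prob s * N.subObj τ s (y τ s))}

/-- Objective values of the two-stage problem with the compact formulation. -/
def fullCompactValues [Fintype Station] (M : BigM) : Set ℝ :=
  {m | ∃ (x : N.Trip → ℝ) (z : N.Trip → Request → Scenario → ℝ)
      (c : (τ : N.Trip) → Scenario → N.CompactVars τ),
    N.FirstStage x z ∧
    (∀ τ s, N.CompactFeasible τ s M (x τ) (fun p => z τ p s) (c τ s)) ∧
    m = ∑ τ, (N.opCost τ.1 * x τ + ∑ s, N.prob s * N.compactObj τ s (c τ s))}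

end Full

end

end MiND

/-! A solution of the subpath formulation is a flow in an acyclic network, and `compactOfSub` reads
off every compact variable as a flow-weighted sum over the used arcs: of visits, moves, pickups,
visiting times or pickup times. The same formula serves fractional and binary flows, so the
comparison of the relaxations and one half of the binary equivalence share one proof. The compact
constraints become conservation laws: pairing flow balance with a potential on the nodes
(`SubLinear.potential`) gives station balance, capacity (potential = load) and the skipping rule
(potential = indicator of one side of a cut). Simplicity enters only through
`SubLinear.visitSum_le`: no location receives more than `x ≤ 1` units of flow. Hence the factors `1
- y`, `1 - w`, `1 - v` are nonnegative, and the big-M slack pays for the missing flow, whose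
visiting times are at most `Tend`. The objectives agree because the cost of a pickup is affine in
its time.

Conversely, in a binary compact solution visiting times strictly increase along used moves, since
travel times are positive. Cycles are thus impossible: a zero flow vanishes
(`eq_zero_of_circulation`) and a unit flow is a single path (`exists_path_of_unit_flow`). Cutting
the path at its checkpoints gives a simple subpath solution (`IsRoute.exists_isItinerary`). No lower
bound on the big-M constants is needed here. The objectives may differ, because `pickTime` is
bounded only from below; the difference is linear in the delays `δ` between visits and pickups.
Postponing by a further `r * δ` is feasible for every `r ≥ 0`, so if the problem is bounded below,
the difference is nonnegative and the subpath solution is at most as expensive. With the inclusion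
of objective values from the other direction, the minima coincide; the two-stage argument is the
same with all trips and scenarios summed.

Strictness is a knapsack gap: with capacity three and two requests of two passengers each, the
compact relaxation serves three quarters of each request, while a single subpath serves whole
requests and hence at most one. The minima are `-3` and `-2`. -/

/-! ### Finitely supported weighted sums and sums over lists -/

/-- The sum of `f` weighted by `y`. -/
noncomputable def weightedSum {α : Type*} (y : α →₀ ℝ) (f : α → ℝ) : ℝ :=
  ∑ a ∈ y.support, y a * f a

section WeightedSum

variable {α : Type*} {y : α →₀ ℝ} {f g : α → ℝ}

theorem weightedSum_eq_sum (y : α →₀ ℝ) (F : α → ℝ → ℝ) (f : α → ℝ)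
    (h : ∀ a r, F a r = r * f a) : y.sum F = weightedSum y f :=
  Finset.sum_congr rfl fun a _ => h a (y a)

theorem weightedSum_add_fun (y : α →₀ ℝ) (f g : α → ℝ) :
    weightedSum y (fun a => f a + g a) = weightedSum y f + weightedSum y g := by
  simp only [weightedSum, mul_add, Finset.sum_add_distrib]

theorem weightedSum_sub_fun (y : α →₀ ℝ) (f g : α → ℝ) :
    weightedSum y (fun a => f a - g a) = weightedSum y f - weightedSum y g := by
  simp only [weightedSum, mul_sub, Finset.sum_sub_distrib]

theorem weightedSum_const_mul (y : α →₀ ℝ) (c : ℝ) (f : α → ℝ) :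
    weightedSum y (fun a => c * f a) = c * weightedSum y f := by
  simp only [weightedSum, Finset.mul_sum]
  exact Finset.sum_congr rfl fun a _ => by ring

theorem weightedSum_finset_sum {ι : Type*} (y : α →₀ ℝ) (t : Finset ι) (f : ι → α → ℝ) :
    weightedSum y (fun a => ∑ i ∈ t, f i a) = ∑ i ∈ t, weightedSum y (f i) := by
  simp only [weightedSum, Finset.mul_sum]
  exact Finset.sum_comm

theorem weightedSum_congr (h : ∀ a, y a ≠ 0 → f a = g a) : weightedSum y f = weightedSum y g :=
  Finset.sum_congr rfl fun a ha => by rw [h a (Finsupp.mem_support_iff.1 ha)]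

theorem weightedSum_mono (hy : ∀ a, 0 ≤ y a) (h : ∀ a, y a ≠ 0 → f a ≤ g a) :
    weightedSum y f ≤ weightedSum y g :=
  Finset.sum_le_sum fun a ha =>
    mul_le_mul_of_nonneg_left (h a (Finsupp.mem_support_iff.1 ha)) (hy a)

theorem weightedSum_nonneg (hy : ∀ a, 0 ≤ y a) (h : ∀ a, y a ≠ 0 → 0 ≤ f a) :
    0 ≤ weightedSum y f :=
  Finset.sum_nonneg fun a ha => mul_nonneg (hy a) (h a (Finsupp.mem_support_iff.1 ha))

/-- Integrality of the constructed compact variables: for a binary flow they are natural numbers, so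
an upper bound of one makes them binary without any rounding. -/
theorem weightedSum_eq_natCast (hy : ∀ a, ∃ n : ℕ, y a = n) (h : ∀ a, ∃ n : ℕ, f a = n) :
    ∃ n : ℕ, weightedSum y f = n := by
  choose u hu using hy
  choose v hv using h
  refine ⟨∑ a ∈ y.support, u a * v a, ?_⟩
  simp only [weightedSum, hu, hv]
  push_cast
  rfl

theorem weightedSum_add (y y' : α →₀ ℝ) (f : α → ℝ) :
    weightedSum (y + y') f = weightedSum y f + weightedSum y' f := by
  have h := fun u : α →₀ ℝ => weightedSum_eq_sum u (fun a r => r * f a) f fun _ _ => rfl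
  rw [← h, ← h, ← h]
  exact Finsupp.sum_add_index' (fun _ => by simp) (fun _ _ _ => by ring)

theorem weightedSum_single (a : α) (r : ℝ) (f : α → ℝ) :
    weightedSum (Finsupp.single a r) f = r * f a := by
  rw [← weightedSum_eq_sum _ (fun a r => r * f a) f fun _ _ => rfl]
  exact Finsupp.sum_single_index (by simp)

end WeightedSum

namespace List

/-- The moves along a route `l` are the consecutive pairs `l.zip l.tail`. This lemma and the next
one turn sums over moves into sums over their origins and over their ends. -/
theorem map_fst_zip_tail {α : Type*} (l : List α) : (l.zip l.tail).map Prod.fst = l.dropLast := by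
  induction l with
  | nil => rfl
  | cons a l ih =>
    cases l with
    | nil => rfl
    | cons b l => simpa using ih

theorem map_snd_zip_tail {α : Type*} (l : List α) : (l.zip l.tail).map Prod.snd = l.tail :=
  List.map_snd_zip (by simp)

theorem IsChain.rel_of_mem_zip_tail {α : Type*} {R : α → α → Prop} {l : List α}
    (h : l.IsChain R) {m : α × α} (hm : m ∈ l.zip l.tail) : R m.1 m.2 := by
  induction l with
  | nil => simp at hm
  | cons a l ih =>
    cases l with
    | nil => simp at hm
    | cons b l =>
      rw [List.isChain_cons_cons] at h
      simp only [tail_cons, zip_cons_cons, mem_cons] at hm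
      rcases hm with rfl | hm
      · exact h.1
      · exact ih h.2 hm

theorem sum_map_finset_sum {α ι : Type*} (l : List α) (t : Finset ι) (f : ι → α → ℝ) :
    ∑ i ∈ t, (l.map (f i)).sum = (l.map fun a => ∑ i ∈ t, f i a).sum := by
  induction l with
  | nil => simp
  | cons a l ih => simp [Finset.sum_add_distrib, ih]

theorem sum_map_indicator_eq_natCast {α : Type*} (l : List α) (P : α → Prop) [DecidablePred P] :
    ∃ n : ℕ, (l.map fun a => if P a then (1 : ℝ) else 0).sum = n := by
  induction l with
  | nil => exact ⟨0, by simp⟩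
  | cons a l ih =>
    obtain ⟨n, hn⟩ := ih
    refine ⟨(if P a then 1 else 0) + n, ?_⟩
    rw [map_cons, sum_cons, hn]
    push_cast
    rfl

theorem sum_map_indicator_fst {α β : Type*} [DecidableEq α] (l : List (α × β)) (i : α) :
    (l.map fun e => if e.1 = i then (1 : ℝ) else 0).sum = (l.map Prod.fst).count i := by
  induction l with
  | nil => simp
  | cons a l ih =>
    rw [map_cons, sum_cons, ih, map_cons, count_cons]
    by_cases h : a.1 = i <;> simp [h, add_comm]

theorem le_sum_map_of_mem {α : Type*} {l : List α} {f : α → ℝ} (hf : ∀ a ∈ l, 0 ≤ f a) {a : α}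
    (ha : a ∈ l) : f a ≤ (l.map f).sum :=
  List.single_le_sum (fun b hb => by
    obtain ⟨c, hc, rfl⟩ := List.mem_map.1 hb
    exact hf c hc) _ (List.mem_map_of_mem ha)

theorem sum_map_nonneg {α : Type*} {l : List α} {f : α → ℝ} (hf : ∀ a ∈ l, 0 ≤ f a) :
    0 ≤ (l.map f).sum := by
  refine List.sum_nonneg fun b hb => ?_
  obtain ⟨a, ha, rfl⟩ := List.mem_map.1 hb
  exact hf a ha

end List

namespace MiND

noncomputable section

open Classical

variable {Station : Type u₁} {Line : Type u₂} {Request : Type u₃} {Scenario : Type u₄}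
  [Fintype Scenario]

/-! ### Timetables and subpaths -/

theorem T_strictMono (N : MiND Station Line Request Scenario) (τ : N.Trip) : StrictMono (N.T τ) :=
  N.sched_strictMono τ.1 τ.2.1 τ.2.2

theorem T_nonneg (N : MiND Station Line Request Scenario) (τ : N.Trip) (k : N.Ck τ) :
    0 ≤ N.T τ k := N.sched_nonneg τ.1 τ.2.1 τ.2.2 k

theorem le_lastCk (N : MiND Station Line Request Scenario) (l : Line) (k : Fin (N.numCk l)) :
    k ≤ N.lastCk l := by
  have := k.2
  simp only [lastCk, Fin.le_def]
  omega

theorem firstCk_ne_lastCk (N : MiND Station Line Request Scenario) (l : Line) :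
    N.firstCk l ≠ N.lastCk l := by
  have := N.two_le_numCk l
  simp only [firstCk, lastCk, ne_eq, Fin.mk.injEq]
  omega

theorem T_le_Tend (N : MiND Station Line Request Scenario) (τ : N.Trip) (k : N.Ck τ) :
    N.T τ k ≤ N.Tend τ := (N.T_strictMono τ).monotone (N.le_lastCk τ.1 k)

theorem Tend_nonneg (N : MiND Station Line Request Scenario) (τ : N.Trip) : 0 ≤ N.Tend τ :=
  N.T_nonneg τ _

section

variable [Fintype Request] {N : MiND Station Line Request Scenario} {τ : N.Trip} {s : Scenario}

/-- Normal form of a route. A route with a single stop would identify the two end checkpoints,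
against `ck_injective` and `u < v`. -/
theorem Subpath.exists_stops_eq (r : N.Subpath τ s) :
    ∃ mid, r.stops = (N.ck τ.1 r.u, N.T τ r.u) :: (mid ++ [(N.ck τ.1 r.v, N.T τ r.v)]) ∧
      ∀ e ∈ mid, ∀ k, e.1 ≠ N.ck τ.1 k := by
  have h1 := r.stops_head
  have h2 := r.stops_last
  have h3 := r.inner_not_ck
  cases hs : r.stops with
  | nil => simp [hs] at h1
  | cons a l =>
    rw [hs] at h1 h2 h3
    simp only [List.head?_cons, Option.some.injEq] at h1
    subst h1
    rcases List.eq_nil_or_concat l with rfl | ⟨mid, b, rfl⟩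
    · simp only [List.getLast?_singleton, Option.some.injEq, Prod.mk.injEq] at h2
      exact absurd (N.ck_injective τ.1 h2.1) r.u_lt_v.ne
    · have hb : b = (N.ck τ.1 r.v, N.T τ r.v) := by
        rw [List.concat_eq_append, ← List.cons_append, List.getLast?_append] at h2
        simpa using h2
      subst hb
      refine ⟨mid, by simp, fun e he k => h3 e ?_ k⟩
      simpa using he

/-- Travel times are positive, so times strictly increase along the stops and stay between the
scheduled times of the two ends. -/
theorem Subpath.time_mem (r : N.Subpath τ s) {e : Station × ℝ} (he : e ∈ r.stops) :
    0 ≤ e.2 ∧ e.2 ≤ N.Tend τ := by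
  obtain ⟨mid, hs, -⟩ := r.exists_stops_eq
  have hc : r.stops.IsChain fun a b => a.2 < b.2 :=
    r.stops_chain.imp fun a b h => by linarith [h.2, N.tt_pos _ _ _ h.1]
  have : Trans (fun a b : Station × ℝ => a.2 < b.2) (fun a b : Station × ℝ => a.2 < b.2)
    (fun a b : Station × ℝ => a.2 < b.2) := ⟨fun h h' => lt_trans h h'⟩
  have hp := hc.pairwise
  rw [hs] at hp he
  have h0 := N.T_nonneg τ r.u
  have h1 := N.T_le_Tend τ r.v
  rw [List.pairwise_cons, List.pairwise_append] at hp
  have h2 : N.T τ r.u < N.T τ r.v := hp.1 (N.ck τ.1 r.v, N.T τ r.v) (by simp)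
  rcases List.mem_cons.1 he with rfl | he
  · exact ⟨h0, by simp only; linarith⟩
  · have h3 := hp.1 _ he
    rcases List.mem_append.1 he with he' | he'
    · have h4 := hp.2.2.2 e he' _ (List.mem_singleton.2 rfl)
      simp only at h3 h4
      exact ⟨by linarith, by linarith⟩
    · rw [List.mem_singleton] at he'
      subst he'
      exact ⟨by simp only; linarith, h1⟩

/-! ### Potentials on the load-expanded network -/

/-- Arcs are infinitely many, but nodes are not; this permits summing the flow balance over all
nodes. -/
instance Node.finite : Finite (N.Node τ) := by
  refine Finite.of_surjective
    (fun o : Option (N.Ck τ × Fin (N.cap τ.1 + 1)) => match o with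
      | none => Node.sink
      | some e => Node.pair e.1 e.2) ?_
  rintro (⟨k, c⟩ | _)
  · exact ⟨some (k, c), rfl⟩
  · exact ⟨none, rfl⟩

/-- Position of a node in the topological order of the network. -/
def Node.rank : N.Node τ → ℕ
  | .pair k _ => k
  | .sink => N.numCk τ.1

theorem Arc.rank_lt (a : N.Arc τ s) : a.start.rank < a.finish.rank := by
  cases a with
  | travel r c c' h => exact r.u_lt_v
  | terminate c => exact (N.lastCk τ.1).2

/-- Summation by parts: multiply the balance at each node by `φ`, sum over the nodes and exchange
the sums. All conservation laws below are choices of `φ`. -/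
theorem SubLinear.potential {x : ℝ} {z : Request → ℝ} {y : N.Arc τ s →₀ ℝ}
    (h : N.SubLinear τ s x z y) (φ : N.Node τ → ℝ) :
    weightedSum y (fun a => φ a.start - φ a.finish) = x * (φ (N.source τ) - φ .sink) := by
  have := Fintype.ofFinite (N.Node τ)
  have key : ∀ e : N.Arc τ s → N.Node τ,
      ∑ n, φ n * (y.sum fun a r => if e a = n then r else 0) = weightedSum y fun a => φ (e a) := by
    intro e
    simp only [Finsupp.sum, Finset.mul_sum, weightedSum]
    rw [Finset.sum_comm]
    refine Finset.sum_congr rfl fun a _ => ?_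
    simp [mul_comm]
  have hne : N.source τ ≠ .sink := by simp [source]
  rw [weightedSum_sub_fun, ← key Arc.start, ← key Arc.finish, ← Finset.sum_sub_distrib]
  simp only [← mul_sub, h.flow]
  have : ∀ n : N.Node τ, φ n * (if n = N.source τ then x else if n = .sink then -x else 0)
      = (if n = N.source τ then φ n * x else 0) + if n = .sink then -(φ n * x) else 0 := by
    intro n
    by_cases h1 : n = N.source τ
    · simp [h1, hne]
    · by_cases h2 : n = .sink
      · subst h2
        simp [h1]
      · simp [h1, h2]
  simp only [this, Finset.sum_add_distrib, Finset.sum_ite_eq', Finset.mem_univ, if_true]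
  ring

end

end

end MiND

namespace MiND

noncomputable section

open Classical

variable {Station : Type u₁} {Line : Type u₂} {Request : Type u₃} {Scenario : Type u₄}
  [Fintype Scenario]

section

variable [Fintype Request] {N : MiND Station Line Request Scenario} {τ : N.Trip} {s : Scenario}

/-! ### Visits, arrivals and moves along the arcs -/

/-- The location-time pairs of an arc, except the head of a traveling arc. -/
def Arc.visits : N.Arc τ s → List (Station × ℝ)
  | .travel r _ _ _ => r.stops.dropLast
  -- A traveling arc omits its head, which the next arc counts as its tail. The terminating arc
  -- therefore carries the visit of the final checkpoint, and each visit is counted once.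
  | .terminate _ => [(N.ck τ.1 (N.lastCk τ.1), N.Tend τ)]

/-- The location-time pairs of an arc, except its tail. -/
def Arc.arrivals : N.Arc τ s → List (Station × ℝ)
  | .travel r _ _ _ => r.stops.tail
  | .terminate _ => []

/-- The moves along an arc. -/
def Arc.moves : N.Arc τ s → List ((Station × ℝ) × (Station × ℝ))
  | .travel r _ _ _ => r.stops.zip r.stops.tail
  | .terminate _ => []

/-- The location-time pair at which a request is picked up along an arc. -/
def Arc.pick (p : Request) : N.Arc τ s → Option (Station × ℝ)
  | .travel r _ _ _ => r.pickup p
  | .terminate _ => none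

/-- Indicator of the terminating arcs. -/
def Arc.ends : N.Arc τ s → ℝ
  | .travel _ _ _ _ => 0
  | .terminate _ => 1

/-- Flow-weighted sum of `g` over the visits. -/
def visitSum (y : N.Arc τ s →₀ ℝ) (g : Station × ℝ → ℝ) : ℝ :=
  weightedSum y fun a => (a.visits.map g).sum

/-- Flow-weighted sum of `g` over the arrivals. -/
def arrivalSum (y : N.Arc τ s →₀ ℝ) (g : Station × ℝ → ℝ) : ℝ :=
  weightedSum y fun a => (a.arrivals.map g).sum

/-- Flow-weighted sum of `g` over the moves. -/
def moveSum (y : N.Arc τ s →₀ ℝ) (g : (Station × ℝ) × (Station × ℝ) → ℝ) : ℝ :=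
  weightedSum y fun a => (a.moves.map g).sum

/-- Flow-weighted sum of `g` over the pickups of a request. -/
def pickSum (y : N.Arc τ s →₀ ℝ) (p : Request) (g : Station × ℝ → ℝ) : ℝ :=
  weightedSum y fun a => (a.pick p).elim 0 g

/-- Inner stops cancel, so visits minus arrivals is a potential difference. This works because a
node determines its location and its time: checkpoints at the ends of arcs are met on schedule. -/
theorem Arc.sum_visits_sub_sum_arrivals (a : N.Arc τ s) (g : Station × ℝ → ℝ) :
    (a.visits.map g).sum - (a.arrivals.map g).sum =
      (match a.start with | .pair k _ => g (N.ck τ.1 k, N.T τ k) | .sink => 0) -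
        (match a.finish with | .pair k _ => g (N.ck τ.1 k, N.T τ k) | .sink => 0) := by
  cases a with
  | travel r c c' h =>
    obtain ⟨mid, hs, -⟩ := r.exists_stops_eq
    simp only [visits, arrivals, start, finish, hs]
    rw [← List.cons_append, List.dropLast_concat]
    simp only [List.map_cons, List.sum_cons, List.cons_append, List.tail_cons, List.map_append,
      List.sum_append, List.map_nil, List.sum_nil]
    ring
  | terminate c => simp [visits, arrivals, start, finish, Tend]

/-- The only visit that starts no move is the one on a terminating arc, which causes the correction.
-/
theorem Arc.sum_map_moves_fst (a : N.Arc τ s) (g : Station × ℝ → ℝ) :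
    (a.moves.map fun m => g m.1).sum =
      (a.visits.map g).sum - g (N.ck τ.1 (N.lastCk τ.1), N.Tend τ) * a.ends := by
  cases a with
  | travel r c c' h =>
    simp only [moves, visits, ends, mul_zero, sub_zero, ← List.map_fst_zip_tail, List.map_map]
    rfl
  | terminate c => simp [moves, visits, ends]

theorem Arc.sum_map_moves_snd (a : N.Arc τ s) (g : Station × ℝ → ℝ) :
    (a.moves.map fun m => g m.2).sum = (a.arrivals.map g).sum := by
  cases a with
  | travel r c c' h =>
    simp only [moves, arrivals]
    conv_rhs => rw [← List.map_snd_zip_tail, List.map_map]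
    rfl
  | terminate c => simp [moves, arrivals]

theorem Arc.mem_moves {a : N.Arc τ s} {m : (Station × ℝ) × (Station × ℝ)} (hm : m ∈ a.moves) :
    N.next τ.1 m.1.1 m.2.1 ∧ m.1.2 + N.tt m.1.1 m.2.1 ≤ m.2.2 ∧ N.Near τ.1 m.1.1 ∧
      N.Near τ.1 m.2.1 ∧ 0 ≤ m.1.2 ∧ m.1.2 ≤ N.Tend τ ∧ 0 ≤ m.2.2 := by
  cases a with
  | travel r c c' h =>
    have hm' : m ∈ r.stops.zip r.stops.tail := hm
    have h1 : m.1 ∈ r.stops := (List.of_mem_zip (a := m.1) (b := m.2) hm').1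
    have h2 : m.2 ∈ r.stops := List.mem_of_mem_tail (List.of_mem_zip (a := m.1) (b := m.2) hm').2
    have h3 := r.stops_chain.rel_of_mem_zip_tail hm'
    exact ⟨h3.1, h3.2, r.stops_near _ h1, r.stops_near _ h2, (r.time_mem h1).1, (r.time_mem h1).2,
      (r.time_mem h2).1⟩
  | terminate c => simp [moves] at hm

theorem Arc.mem_visits {a : N.Arc τ s} {e : Station × ℝ} (he : e ∈ a.visits) :
    0 ≤ e.2 ∧ e.2 ≤ N.Tend τ := by
  cases a with
  | travel r c c' h => exact r.time_mem (List.mem_of_mem_dropLast he)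
  | terminate c =>
    rw [visits, List.mem_singleton] at he
    subst he
    exact ⟨N.Tend_nonneg τ, le_rfl⟩

theorem Arc.mem_arrivals {a : N.Arc τ s} {e : Station × ℝ} (he : e ∈ a.arrivals) :
    0 ≤ e.2 ∧ e.2 ≤ N.Tend τ := by
  cases a with
  | travel r c c' h => exact r.time_mem (List.mem_of_mem_tail he)
  | terminate c => simp [arrivals] at he

theorem Arc.pick_mem {a : N.Arc τ s} {p : Request} {e : Station × ℝ} (he : a.pick p = some e) :
    N.IsPickup τ p e.1 ∧ N.earliest τ p e.1 ≤ e.2 ∧ e.2 ≤ N.latest τ p e.1 ∧ 0 ≤ e.2 ∧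
      e.2 ≤ N.Tend τ := by
  cases a with
  | travel r c c' h =>
    have := r.pickup_time p e he
    have h2 := r.time_mem (Subpath.pickup_stop r p e he)
    exact ⟨r.pickup_location p e he, this.1, this.2, h2.1, h2.2⟩
  | terminate c => simp [pick] at he

/-- By `pickup_end`, passengers at the head of a subpath are left to the next subpath, so a pickup
away from the final checkpoint never happens at the omitted head. -/
theorem Arc.pick_mem_visits {a : N.Arc τ s} {p : Request} {e : Station × ℝ}
    (he : a.pick p = some e) (hl : e.1 ≠ N.ck τ.1 (N.lastCk τ.1)) : e ∈ a.visits := by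
  cases a with
  | travel r c c' h =>
    have h1 := Subpath.pickup_stop r p e he
    have h2 := r.pickup_end p e he
    obtain ⟨mid, hs, -⟩ := r.exists_stops_eq
    simp only [visits, hs]
    rw [← List.cons_append, List.dropLast_concat]
    rw [hs, ← List.cons_append, List.mem_append, List.mem_singleton] at h1
    rcases h1 with h1 | h1
    · exact h1
    · rw [h1] at h2 hl
      exact absurd (congrArg _ (h2 rfl)) hl
  | terminate c => simp [pick] at he

theorem Arc.pick_mem_arrivals {a : N.Arc τ s} {p : Request} {e : Station × ℝ}
    (he : a.pick p = some e) (hl : e.1 = N.ck τ.1 (N.lastCk τ.1)) : e ∈ a.arrivals := by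
  cases a with
  | travel r c c' h =>
    have h1 := Subpath.pickup_stop r p e he
    obtain ⟨mid, hs, -⟩ := r.exists_stops_eq
    simp only [arrivals, hs, List.tail_cons]
    rw [hs, List.mem_cons] at h1
    rcases h1 with h1 | h1
    · rw [h1] at hl
      have := N.ck_injective τ.1 hl
      exact absurd (N.le_lastCk τ.1 r.v) (not_le.2 (this ▸ r.u_lt_v))
    · exact h1
  | terminate c => simp [pick] at he

/-! ### Conservation laws -/

variable {x : ℝ} {z : Request → ℝ} {y : N.Arc τ s →₀ ℝ}

/-- The only visit that is not an arrival is the start of the trip, which carries `x` units of flow.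
-/
theorem SubLinear.visitSum_eq (h : N.SubLinear τ s x z y) (g : Station × ℝ → ℝ) :
    visitSum y g = arrivalSum y g +
      x * g (N.ck τ.1 (N.firstCk τ.1), N.T τ (N.firstCk τ.1)) := by
  have h1 := h.potential fun n => match n with
    | .pair k _ => g (N.ck τ.1 k, N.T τ k)
    | .sink => 0
  simp only [← Arc.sum_visits_sub_sum_arrivals, weightedSum_sub_fun, source, sub_zero] at h1
  rw [visitSum, arrivalSum]
  linarith

theorem SubLinear.weightedSum_ends (h : N.SubLinear τ s x z y) : weightedSum y Arc.ends = x := by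
  have h1 := h.potential fun n => match n with
    | .pair _ _ => 1
    | .sink => 0
  simp only [source, sub_zero, mul_one] at h1
  rw [← h1]
  exact weightedSum_congr fun a _ => by cases a <;> simp [Arc.ends, Arc.start, Arc.finish]

theorem SubLinear.moveSum_fst (h : N.SubLinear τ s x z y) (g : Station × ℝ → ℝ) :
    moveSum y (fun m => g m.1) =
      visitSum y g - g (N.ck τ.1 (N.lastCk τ.1), N.Tend τ) * x := by
  simp only [moveSum, Arc.sum_map_moves_fst, weightedSum_sub_fun, weightedSum_const_mul,
    h.weightedSum_ends]
  rfl

theorem moveSum_snd (y : N.Arc τ s →₀ ℝ) (g : Station × ℝ → ℝ) :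
    moveSum y (fun m => g m.2) = arrivalSum y g := by
  simp only [moveSum, Arc.sum_map_moves_snd]
  rfl

/-- The potential is the load, set to the full capacity at the sink. Traveling arcs raise it by the
passengers they pick up and terminating arcs by the unused capacity, which is nonnegative; the total
rise is `cap * x`. -/
theorem SubLinear.capacity (h : N.SubLinear τ s x z y) (hy : ∀ a, 0 ≤ y a) :
    ∑ p, (N.demand p s : ℝ) * pickSum y p (fun _ => 1) ≤ N.cap τ.1 * x := by
  have h1 := h.potential fun n => match n with
    | .pair _ c => (c : ℕ)
    | .sink => N.cap τ.1
  have h2 : weightedSum y (fun a => ∑ p, (N.demand p s : ℝ) * (a.pick p).elim 0 fun _ => 1) ≤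
      weightedSum y fun a => -((match a.start with | .pair _ c => ((c : ℕ) : ℝ) | .sink => N.cap τ.1)
        - match a.finish with | .pair _ c => ((c : ℕ) : ℝ) | .sink => N.cap τ.1) := by
    refine weightedSum_mono hy fun a _ => ?_
    cases a with
    | travel r c c' h =>
      simp only [Arc.start, Arc.finish, h, Subpath.load, Arc.pick]
      push_cast
      refine le_of_eq ?_
      ring_nf
      refine Finset.sum_congr rfl fun p _ => ?_
      cases r.pickup p <;> simp
    | terminate c =>
      have : ((c : ℕ) : ℝ) ≤ N.cap τ.1 := by exact_mod_cast Nat.lt_succ_iff.1 c.2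
      simpa [Arc.start, Arc.finish, Arc.pick] using this
  have h3 : ∀ f : N.Arc τ s → ℝ, weightedSum y (fun a => -f a) = - weightedSum y f := by
    intro f
    have := weightedSum_const_mul y (-1) f
    simpa using this
  rw [h3, h1, weightedSum_finset_sum] at h2
  simp only [weightedSum_const_mul] at h2
  simp only [source, Fin.val_zero, Nat.cast_zero, zero_sub] at h2
  refine h2.trans (le_of_eq (by ring))

/-- Pickups at a location are dominated by the visits of that location. -/
theorem SubLinear.pickSum_le (h : N.SubLinear τ s x z y) (hy : ∀ a, 0 ≤ y a) (hx : 0 ≤ x)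
    (p : Request) (i : Station) (f : ℝ → ℝ) (hf : ∀ t, 0 ≤ t → t ≤ N.Tend τ → 0 ≤ f t) :
    pickSum y p (fun e => if e.1 = i then f e.2 else 0) ≤
      visitSum y fun e => if e.1 = i then f e.2 else 0 := by
  -- At the final checkpoint a pickup belongs to the arc that arrives there, so it is compared with
  -- arrivals; anywhere else it is a visit of its own arc.
  by_cases hi : i = N.ck τ.1 (N.lastCk τ.1)
  · rw [h.visitSum_eq]
    have h0 : 0 ≤ x * (if N.ck τ.1 (N.firstCk τ.1) = i then f (N.T τ (N.firstCk τ.1)) else 0) := by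
      refine mul_nonneg hx ?_
      split_ifs
      · exact hf _ (N.T_nonneg τ _) (N.T_le_Tend τ _)
      · exact le_rfl
    refine le_trans ?_ (le_add_of_nonneg_right h0)
    refine weightedSum_mono hy fun a _ => ?_
    have hn : ∀ e ∈ a.arrivals, 0 ≤ (if e.1 = i then f e.2 else 0) := fun e he => by
      split_ifs
      · exact hf _ (Arc.mem_arrivals he).1 (Arc.mem_arrivals he).2
      · exact le_rfl
    cases hp : a.pick p with
    | none => exact List.sum_map_nonneg hn
    | some e =>
      by_cases he : e.1 = i
      · exact List.le_sum_map_of_mem (f := fun e => if e.1 = i then f e.2 else 0) hn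
          (Arc.pick_mem_arrivals hp (he.trans hi))
      · simp only [Option.elim, he, if_false]
        exact List.sum_map_nonneg hn
  · refine weightedSum_mono hy fun a _ => ?_
    have hn : ∀ e ∈ a.visits, 0 ≤ (if e.1 = i then f e.2 else 0) := fun e he => by
      split_ifs
      · exact hf _ (Arc.mem_visits he).1 (Arc.mem_visits he).2
      · exact le_rfl
    cases hp : a.pick p with
    | none => exact List.sum_map_nonneg hn
    | some e =>
      by_cases he : e.1 = i
      · exact List.le_sum_map_of_mem (f := fun e => if e.1 = i then f e.2 else 0) hn
          (Arc.pick_mem_visits hp (he ▸ hi))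
      · simp only [Option.elim, he, if_false]
        exact List.sum_map_nonneg hn

/-! ### Cuts -/

theorem Arc.sum_visits_le_of_forall_ne_ck (a : N.Arc τ s) (i : Station) (hi : ∀ k, i ≠ N.ck τ.1 k)
    (hn : a.stations.Nodup) :
    (a.visits.map fun e => if e.1 = i then (1 : ℝ) else 0).sum ≤ if i ∈ a.inner then 1 else 0 := by
  rw [List.sum_map_indicator_fst]
  cases a with
  | travel r c c' h =>
    obtain ⟨mid, hs, -⟩ := r.exists_stops_eq
    simp only [stations, inner, visits, hs] at hn ⊢
    rw [← List.cons_append, List.dropLast_concat]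
    rw [← List.cons_append, List.map_append] at hn
    have h1 := List.nodup_iff_count_le_one.1 hn.of_append_left i
    have h2 : ((((N.ck τ.1 r.u, N.T τ r.u) :: (mid ++ [(N.ck τ.1 r.v, N.T τ r.v)])).map
        Prod.fst).tail).dropLast = mid.map Prod.fst := by simp
    rw [← List.cons_append] at h2
    rw [h2]
    split_ifs with h3
    · exact_mod_cast h1
    · have : List.count i (((N.ck τ.1 r.u, N.T τ r.u) :: mid).map Prod.fst) = 0 := by
        rw [List.count_eq_zero, List.map_cons, List.mem_cons, not_or]
        exact ⟨hi _, h3⟩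
      exact_mod_cast this.le
  | terminate c =>
    simp [visits, inner, stations, Ne.symm (hi _)]

/-- Inner stops are never checkpoints, so the only checkpoint that an arc visits is its tail. -/
theorem Arc.sum_visits_ck (a : N.Arc τ s) (k : N.Ck τ) :
    (a.visits.map fun e => if e.1 = N.ck τ.1 k then (1 : ℝ) else 0).sum =
      if a.start.rank = k then 1 else 0 := by
  rw [List.sum_map_indicator_fst]
  cases a with
  | travel r c c' h =>
    obtain ⟨mid, hs, hm⟩ := r.exists_stops_eq
    simp only [visits, hs, start, Node.rank]
    rw [← List.cons_append, List.dropLast_concat, List.map_cons, List.count_cons]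
    have : List.count (N.ck τ.1 k) (mid.map Prod.fst) = 0 := by
      rw [List.count_eq_zero, List.mem_map]
      rintro ⟨e, he, h'⟩
      exact hm e he k h'
    simp only [this, (N.ck_injective τ.1).eq_iff, beq_iff_eq, Fin.ext_iff]
    by_cases h' : (r.u : ℕ) = k <;> simp [h']
  | terminate c =>
    simp only [visits, List.map_cons, List.map_nil, List.count_cons, List.count_nil, start,
      Node.rank, (N.ck_injective τ.1).eq_iff, beq_iff_eq, Fin.ext_iff]
    by_cases h' : (N.lastCk τ.1 : ℕ) = k <;> simp [h']

/-- The flow across the cut after a checkpoint. -/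
theorem SubLinear.cut (h : N.SubLinear τ s x z y) (k : N.Ck τ) :
    weightedSum y (fun a => if a.start.rank ≤ k ∧ (k : ℕ) < a.finish.rank then 1 else 0) = x := by
  -- Arcs increase the rank, so none crosses the cut backwards and the potential difference is the
  -- indicator of crossing.
  have h1 := h.potential fun n => if n.rank ≤ k then 1 else 0
  have h2 : (N.source τ).rank ≤ k := Nat.zero_le _
  have h3 : ¬ (Node.sink : N.Node τ).rank ≤ k := not_le.2 k.2
  rw [if_pos h2, if_neg h3, sub_zero, mul_one] at h1
  rw [← h1]
  refine weightedSum_congr fun a _ => ?_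
  have := a.rank_lt
  by_cases h4 : a.start.rank ≤ k <;> by_cases h5 : (k : ℕ) < a.finish.rank
  · simp [h4, h5, not_le.2 h5]
  · simp [h4, h5, not_lt.1 h5]
  · simp [h4, h5]
  · omega

/-- Use the cut after checkpoint `k + K`. An arc across it skips at most `K` checkpoints, so it
starts at one of `k, …, k + K`, and that start is a visit counted in the window. -/
theorem SubLinear.le_window (h : N.SubLinear τ s x z y) (hy : ∀ a, 0 ≤ y a) (k : N.Ck τ)
    (hk : (k : ℕ) + N.K < N.numCk τ.1) :
    x ≤ ∑ k' : N.Ck τ, (if (k : ℕ) ≤ k' ∧ (k' : ℕ) ≤ k + N.K then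
      visitSum y (fun e => if e.1 = N.ck τ.1 k' then 1 else 0) else 0) := by
  rw [← h.cut ⟨k + N.K, hk⟩]
  have : ∀ k' : N.Ck τ, (if (k : ℕ) ≤ k' ∧ (k' : ℕ) ≤ k + N.K then
      visitSum y (fun e => if e.1 = N.ck τ.1 k' then 1 else 0) else 0) =
      weightedSum y fun a => if (k : ℕ) ≤ k' ∧ (k' : ℕ) ≤ k + N.K then
        (if a.start.rank = k' then 1 else 0) else 0 := by
    intro k'
    split_ifs
    · simp only [visitSum, Arc.sum_visits_ck]
    · simp [weightedSum]
  simp only [this]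
  rw [← weightedSum_finset_sum]
  refine weightedSum_mono hy fun a _ => ?_
  have hnn : ∀ k' : N.Ck τ, (0 : ℝ) ≤ if (k : ℕ) ≤ k' ∧ (k' : ℕ) ≤ k + N.K then
        (if a.start.rank = k' then 1 else 0) else 0 := fun k' => by split_ifs <;> norm_num
  split_ifs with hc
  · have hlt : a.start.rank < N.numCk τ.1 := lt_of_le_of_lt hc.1 hk
    have hle : (k : ℕ) ≤ a.start.rank := by
      cases a with
      | travel r c c' h' =>
        have h1 := r.skip
        have h2 : (k : ℕ) + N.K < r.v := hc.2
        show (k : ℕ) ≤ r.u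
        omega
      | terminate c =>
        show (k : ℕ) ≤ N.lastCk τ.1
        exact N.le_lastCk τ.1 k
    refine le_trans ?_ (Finset.single_le_sum (fun k' _ => hnn k')
      (Finset.mem_univ (⟨a.start.rank, hlt⟩ : N.Ck τ)))
    have hc1 : a.start.rank ≤ k + N.K := hc.1
    simp [hle, hc1]
  · exact Finset.sum_nonneg fun k' _ => hnn k'

theorem Follows.rank_lt_of_transGen {a b : N.Arc τ s} (h : Relation.TransGen (Follows y) a b) :
    a.start.rank < b.start.rank := by
  induction h with
  | single h => exact h.2.2 ▸ a.rank_lt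
  | @tail b c _ h ih => exact ih.trans (h.2.2 ▸ b.rank_lt)

/-- Under a simple solution, no location receives more flow than there is. -/
theorem SubLinear.visitSum_le (h : N.SubLinear τ s x z y) (hy : ∀ a, 0 ≤ y a) (hx : 0 ≤ x)
    (hs : VisitsOnce y) (i : Station) : visitSum y (fun e => if e.1 = i then 1 else 0) ≤ x := by
  by_cases hi : ∃ k, i = N.ck τ.1 k
  · obtain ⟨k, rfl⟩ := hi
    -- Every arc that leaves checkpoint `k` crosses the cut after `k`; simplicity is needed only for
    -- locations that are not checkpoints.
    conv_rhs => rw [← h.cut k]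
    simp only [visitSum, Arc.sum_visits_ck]
    refine weightedSum_mono hy fun a _ => ?_
    have := a.rank_lt
    split_ifs with h1 h2
    · exact le_rfl
    · omega
    · norm_num
    · exact le_rfl
  · push Not at hi
    -- `R` is the set of nodes that a vehicle can reach along used arcs after having visited `i`. By
    -- simplicity an arc that visits `i` enters `R` from outside, and no used arc leaves `R`; so the
    -- visits of `i` are bounded by the net flow into `R`, which is at most `x`.
    let R : N.Node τ → Prop := fun n => ∃ a, y a ≠ 0 ∧ i ∈ a.inner ∧
      (a.finish = n ∨ ∃ b, Relation.TransGen (Follows y) a b ∧ b.finish = n)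
    have h1 := h.potential fun n => if R n then 0 else 1
    have h2 : visitSum y (fun e => if e.1 = i then 1 else 0) ≤
        weightedSum y fun a => (if R a.start then 0 else 1) - (if R a.finish then 0 else 1) := by
      refine weightedSum_mono hy fun a ha => ?_
      refine (a.sum_visits_le_of_forall_ne_ck i hi (hs.1 a ha)).trans ?_
      by_cases h3 : i ∈ a.inner
      · have h4 : R a.finish := ⟨a, ha, h3, Or.inl rfl⟩
        have h5 : ¬ R a.start := by
          rintro ⟨b, hb, hib, h5⟩
          have h6 : Relation.TransGen (Follows y) b a := by
            rcases h5 with h5 | ⟨c, hc, h5⟩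
            · exact .single ⟨hb, ha, h5⟩
            · have hyc : y c ≠ 0 := by
                cases hc with
                | single h => exact h.2.1
                | tail _ h => exact h.2.1
              exact hc.tail ⟨hyc, ha, h5⟩
          exact hs.2 _ _ h6 hib h3
        simp [h3, h4, h5]
      · have h4 : R a.start → R a.finish := by
          rintro ⟨b, hb, hib, h5⟩
          refine ⟨b, hb, hib, Or.inr ⟨a, ?_, rfl⟩⟩
          rcases h5 with h5 | ⟨c, hc, h5⟩
          · exact .single ⟨hb, ha, h5⟩
          · have hyc : y c ≠ 0 := by
              cases hc with
              | single h => exact h.2.1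
              | tail _ h => exact h.2.1
            exact hc.tail ⟨hyc, ha, h5⟩
        by_cases h5 : R a.start
        · simp [h3, h5, h4 h5]
        · simp only [h3, h5, if_false]
          split_ifs <;> norm_num
    refine h2.trans (h1.le.trans ?_)
    have : ∀ a b : ℝ, a ≤ 1 → 0 ≤ b → x * (a - b) ≤ x := fun a b ha hb => by nlinarith
    refine this _ _ ?_ ?_ <;> split_ifs <;> norm_num

end

end

end MiND

namespace MiND

noncomputable section

open Classical

variable {Station : Type u₁} {Line : Type u₂} {Request : Type u₃} {Scenario : Type u₄}
  [Fintype Scenario]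

/-! ### Sufficient size of the big-M constants, and calculus of the flow-weighted sums -/

theorem ck_first_ne_last (N : MiND Station Line Request Scenario) (l : Line) :
    N.ck l (N.firstCk l) ≠ N.ck l (N.lastCk l) :=
  fun h => N.firstCk_ne_lastCk l (N.ck_injective l h)

/-- The big-M parameters dominate all times that matter for a trip. -/
structure Dominates (N : MiND Station Line Request Scenario) (M : BigM) (τ : N.Trip) : Prop where
  travel : ∀ i j, N.tt i j + N.Tend τ ≤ M.mTravel
  tend : N.Tend τ ≤ M.mTravel
  earliest : ∀ p i, N.earliest τ p i ≤ M.mTravel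
  latest : ∀ p i, N.Tend τ - N.latest τ p i ≤ M.mTravel
  sched : N.Tend τ ≤ M.mSched
  visit : N.Tend τ ≤ M.mVisit

/-- Only finitely many numbers have to be dominated: departure times form a `Finset`, so there are
finitely many trips, and the bounds involve neither `x`, `z` nor the scenario. -/
theorem exists_dominates [Fintype Station] [Fintype Line] [Fintype Request]
    (N : MiND Station Line Request Scenario) :
    ∃ B : ℝ, ∀ M : BigM, M.AtLeast B → ∀ τ, N.Dominates M τ := by
  obtain ⟨B₁, h₁⟩ := (Set.finite_range
    fun q : N.Trip × Station × Station => N.tt q.2.1 q.2.2 + N.Tend q.1).bddAbove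
  obtain ⟨B₂, h₂⟩ := (Set.finite_range N.Tend).bddAbove
  obtain ⟨B₃, h₃⟩ := (Set.finite_range
    fun q : N.Trip × Request × Station => N.earliest q.1 q.2.1 q.2.2).bddAbove
  obtain ⟨B₄, h₄⟩ := (Set.finite_range
    fun q : N.Trip × Request × Station => N.Tend q.1 - N.latest q.1 q.2.1 q.2.2).bddAbove
  refine ⟨max (max B₁ B₂) (max B₃ B₄), fun M ⟨hM₁, hM₂, hM₃⟩ τ => ?_⟩
  simp only [max_le_iff] at hM₁ hM₂ hM₃
  exact
    { travel := fun i j => (h₁ ⟨(τ, i, j), rfl⟩).trans hM₁.1.1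
      tend := (h₂ ⟨τ, rfl⟩).trans hM₁.1.2
      earliest := fun p i => (h₃ ⟨(τ, p, i), rfl⟩).trans hM₁.2.1
      latest := fun p i => (h₄ ⟨(τ, p, i), rfl⟩).trans hM₁.2.2
      sched := (h₂ ⟨τ, rfl⟩).trans hM₂.1.2
      visit := (h₂ ⟨τ, rfl⟩).trans hM₃.1.2 }

section

variable [Fintype Request] {N : MiND Station Line Request Scenario} {τ : N.Trip} {s : Scenario}
variable {x : ℝ} {z : Request → ℝ} {y : N.Arc τ s →₀ ℝ}

theorem visitSum_mono (hy : ∀ a, 0 ≤ y a) {f g : Station × ℝ → ℝ}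
    (h : ∀ e : Station × ℝ, 0 ≤ e.2 → e.2 ≤ N.Tend τ → f e ≤ g e) :
    visitSum y f ≤ visitSum y g :=
  weightedSum_mono hy fun _ _ => List.sum_le_sum fun e he =>
    h e (Arc.mem_visits he).1 (Arc.mem_visits he).2

theorem visitSum_nonneg (hy : ∀ a, 0 ≤ y a) {f : Station × ℝ → ℝ}
    (h : ∀ e : Station × ℝ, 0 ≤ e.2 → e.2 ≤ N.Tend τ → 0 ≤ f e) : 0 ≤ visitSum y f :=
  weightedSum_nonneg hy fun _ _ => List.sum_map_nonneg fun e he =>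
    h e (Arc.mem_visits he).1 (Arc.mem_visits he).2

theorem moveSum_mono (hy : ∀ a, 0 ≤ y a) {f g : (Station × ℝ) × (Station × ℝ) → ℝ}
    (h : ∀ m : (Station × ℝ) × (Station × ℝ), m.1.2 + N.tt m.1.1 m.2.1 ≤ m.2.2 → 0 ≤ m.1.2 →
      m.1.2 ≤ N.Tend τ → 0 ≤ m.2.2 → f m ≤ g m) :
    moveSum y f ≤ moveSum y g :=
  weightedSum_mono hy fun _ _ => List.sum_le_sum fun m hm => by
    obtain ⟨-, h1, -, -, h2, h3, h4⟩ := Arc.mem_moves hm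
    exact h m h1 h2 h3 h4

theorem moveSum_nonneg (hy : ∀ a, 0 ≤ y a) {f : (Station × ℝ) × (Station × ℝ) → ℝ}
    (h : ∀ m, 0 ≤ f m) : 0 ≤ moveSum y f :=
  weightedSum_nonneg hy fun _ _ => List.sum_map_nonneg fun m _ => h m

theorem pickSum_mono (hy : ∀ a, 0 ≤ y a) {p : Request} {f g : Station × ℝ → ℝ}
    (h : ∀ e : Station × ℝ, N.earliest τ p e.1 ≤ e.2 → e.2 ≤ N.latest τ p e.1 → 0 ≤ e.2 →
      f e ≤ g e) :
    pickSum y p f ≤ pickSum y p g := by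
  refine weightedSum_mono hy fun a _ => ?_
  cases hp : a.pick p with
  | none => exact le_rfl
  | some e =>
    obtain ⟨-, h1, h2, h3, -⟩ := Arc.pick_mem hp
    exact h e h1 h2 h3

theorem pickSum_nonneg (hy : ∀ a, 0 ≤ y a) {p : Request} {f : Station × ℝ → ℝ}
    (h : ∀ e : Station × ℝ, 0 ≤ e.2 → 0 ≤ f e) : 0 ≤ pickSum y p f := by
  refine weightedSum_nonneg hy fun a _ => ?_
  cases hp : a.pick p with
  | none => exact le_rfl
  | some e => exact h e (Arc.pick_mem hp).2.2.2.1

theorem visitSum_const_mul (c : ℝ) (f : Station × ℝ → ℝ) :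
    visitSum y (fun e => c * f e) = c * visitSum y f := by
  simp only [visitSum, List.sum_map_mul_left, weightedSum_const_mul]

theorem visitSum_add (f g : Station × ℝ → ℝ) :
    visitSum y (fun e => f e + g e) = visitSum y f + visitSum y g := by
  simp only [visitSum, List.sum_map_add, weightedSum_add_fun]

theorem moveSum_const_mul (c : ℝ) (f : (Station × ℝ) × (Station × ℝ) → ℝ) :
    moveSum y (fun e => c * f e) = c * moveSum y f := by
  simp only [moveSum, List.sum_map_mul_left, weightedSum_const_mul]

theorem moveSum_add (f g : (Station × ℝ) × (Station × ℝ) → ℝ) :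
    moveSum y (fun e => f e + g e) = moveSum y f + moveSum y g := by
  simp only [moveSum, List.sum_map_add, weightedSum_add_fun]

theorem pickSum_const_mul (p : Request) (c : ℝ) (f : Station × ℝ → ℝ) :
    pickSum y p (fun e => c * f e) = c * pickSum y p f := by
  rw [pickSum, pickSum, ← weightedSum_const_mul]
  exact weightedSum_congr fun a _ => by cases a.pick p <;> simp

theorem pickSum_add (p : Request) (f g : Station × ℝ → ℝ) :
    pickSum y p (fun e => f e + g e) = pickSum y p f + pickSum y p g := by
  rw [pickSum, pickSum, pickSum, ← weightedSum_add_fun]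
  exact weightedSum_congr fun a _ => by cases a.pick p <;> simp

theorem moveSum_finset_sum {ι : Type*} (t : Finset ι)
    (f : ι → (Station × ℝ) × (Station × ℝ) → ℝ)
    (g : (Station × ℝ) × (Station × ℝ) → ℝ)
    (h : ∀ m : (Station × ℝ) × (Station × ℝ), N.next τ.1 m.1.1 m.2.1 → N.Near τ.1 m.1.1 →
      N.Near τ.1 m.2.1 → ∑ i ∈ t, f i m = g m) :
    ∑ i ∈ t, moveSum y (f i) = moveSum y g := by
  simp only [moveSum]
  rw [← weightedSum_finset_sum]
  refine weightedSum_congr fun a _ => ?_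
  rw [List.sum_map_finset_sum]
  refine congrArg List.sum (List.map_congr_left fun m hm => ?_)
  obtain ⟨h1, -, h2, h3, -⟩ := Arc.mem_moves hm
  exact h m h1 h2 h3

theorem pickSum_finset_sum [Fintype Station] (p : Request) (g : Station → ℝ) :
    ∑ i ∈ N.pickupSet τ p, g i * pickSum y p (fun e => if e.1 = i then 1 else 0) =
      pickSum y p fun e => g e.1 := by
  simp only [← pickSum_const_mul]
  simp only [pickSum]
  rw [← weightedSum_finset_sum]
  refine weightedSum_congr fun a _ => ?_
  cases hp : a.pick p with
  | none => simp
  | some e =>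
    have : e.1 ∈ N.pickupSet τ p := by simpa [pickupSet] using (Arc.pick_mem hp).1
    simp [this]

/-! ### The compact solution built from a simple subpath solution -/

/-- The compact solution obtained from a solution of the subpath formulation. -/
def compactOfSub (y : N.Arc τ s →₀ ℝ) : N.CompactVars τ where
  v k := visitSum y fun e => if e.1 = N.ck τ.1 k then 1 else 0
  y i j := moveSum y fun m => if m.1.1 = i ∧ m.2.1 = j then 1 else 0
  w p i := pickSum y p fun e => if e.1 = i then 1 else 0
  -- The times are weighted by the flow and not divided by it, so a location visited by a fraction
  -- of the flow gets a time that is too small; the terms `M * (1 - …)` absorb this.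
  visitTime i := visitSum y fun e => if e.1 = i then e.2 else 0
  pickTime p := pickSum y p fun e => e.2

/-- Every visit continues with a move, except the last visit of the trip; dually, in `inn_eq`, every
visit except the first is the end of a move. -/
theorem SubLinear.out_eq [Fintype Station] (h : N.SubLinear τ s x z y) (i : Station) :
    (compactOfSub y).out i = visitSum y (fun e => if e.1 = i then 1 else 0) -
      if i = N.ck τ.1 (N.lastCk τ.1) then x else 0 := by
  have h1 := h.moveSum_fst fun e => if e.1 = i then 1 else 0
  simp only [ite_mul, one_mul, zero_mul, eq_comm (a := N.ck τ.1 (N.lastCk τ.1))] at h1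
  rw [← h1]
  refine moveSum_finset_sum _ _ _ fun m hm1 _ hm3 => ?_
  by_cases hi : m.1.1 = i
  · subst hi
    simp [succs, hm1, hm3]
  · simp [hi]

theorem SubLinear.inn_eq [Fintype Station] (h : N.SubLinear τ s x z y) (i : Station) :
    (compactOfSub y).inn i = visitSum y (fun e => if e.1 = i then 1 else 0) -
      if i = N.ck τ.1 (N.firstCk τ.1) then x else 0 := by
  have h1 := h.visitSum_eq fun e => if e.1 = i then 1 else 0
  have h2 : arrivalSum y (fun e => if e.1 = i then 1 else 0) =
      visitSum y (fun e => if e.1 = i then 1 else 0) -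
      if i = N.ck τ.1 (N.firstCk τ.1) then x else 0 := by
    rw [h1]
    by_cases hi : i = N.ck τ.1 (N.firstCk τ.1)
    · simp [← hi]
    · simp [hi, Ne.symm hi]
  rw [← h2, ← moveSum_snd]
  refine moveSum_finset_sum _ _ _ fun m hm1 hm2 _ => ?_
  by_cases hi : m.2.1 = i
  · subst hi
    simp [preds, hm1, hm2]
  · simp [hi]

theorem compactOfSub_y_nonneg (hy : ∀ a, 0 ≤ y a) (i j : Station) :
    0 ≤ (compactOfSub y).y i j :=
  moveSum_nonneg hy fun m => by split_ifs <;> norm_num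

theorem compactOfSub_out_nonneg [Fintype Station] (hy : ∀ a, 0 ≤ y a) (i : Station) :
    0 ≤ (compactOfSub y).out i :=
  Finset.sum_nonneg fun j _ => compactOfSub_y_nonneg hy i j

theorem compactOfSub_inn_nonneg [Fintype Station] (hy : ∀ a, 0 ≤ y a) (i : Station) :
    0 ≤ (compactOfSub y).inn i :=
  Finset.sum_nonneg fun j _ => compactOfSub_y_nonneg hy j i

/-- The first and the last checkpoint differ, so at each location at least one of outflow and inflow
accounts for all visits. -/
theorem SubLinear.visits_le_out_add_inn [Fintype Station]
    (h : N.SubLinear τ s x z y) (hy : ∀ a, 0 ≤ y a)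
    (i : Station) : visitSum y (fun e => if e.1 = i then 1 else 0) ≤
      (compactOfSub y).out i + (compactOfSub y).inn i := by
  have h1 := h.out_eq i
  have h2 := h.inn_eq i
  have h3 := compactOfSub_out_nonneg hy i
  have h4 := compactOfSub_inn_nonneg hy i
  by_cases hi : i = N.ck τ.1 (N.lastCk τ.1)
  · have : i ≠ N.ck τ.1 (N.firstCk τ.1) := hi ▸ (N.ck_first_ne_last τ.1).symm
    rw [if_neg this] at h2
    linarith
  · rw [if_neg hi] at h1
    linarith

theorem SubLinear.y_le_visits_fst (h : N.SubLinear τ s x z y) (hy : ∀ a, 0 ≤ y a) (hx : 0 ≤ x)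
    (i j : Station) :
    (compactOfSub y).y i j ≤ visitSum y (fun e => if e.1 = i then 1 else 0) := by
  have h1 := h.moveSum_fst fun e => if e.1 = i then 1 else 0
  have h2 : (compactOfSub y).y i j ≤ moveSum y fun m => if m.1.1 = i then 1 else 0 :=
    moveSum_mono hy fun m _ _ _ _ => by
      by_cases h : m.1.1 = i <;> by_cases h' : m.2.1 = j <;> simp [h, h']
  have h3 : 0 ≤ (if N.ck τ.1 (N.lastCk τ.1) = i then 1 else 0) * x :=
    mul_nonneg (by split_ifs <;> norm_num) hx
  linarith

theorem SubLinear.y_le_visits_snd (h : N.SubLinear τ s x z y) (hy : ∀ a, 0 ≤ y a) (hx : 0 ≤ x)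
    (i j : Station) :
    (compactOfSub y).y i j ≤ visitSum y (fun e => if e.1 = j then 1 else 0) := by
  have h1 := h.visitSum_eq fun e => if e.1 = j then 1 else 0
  rw [← moveSum_snd] at h1
  have h2 : (compactOfSub y).y i j ≤ moveSum y fun m => if m.2.1 = j then 1 else 0 :=
    moveSum_mono hy fun m _ _ _ _ => by
      by_cases h : m.1.1 = i <;> by_cases h' : m.2.1 = j <;> simp [h, h']
  have h3 : 0 ≤ x * (if N.ck τ.1 (N.firstCk τ.1) = j then 1 else 0) :=
    mul_nonneg hx (by split_ifs <;> norm_num)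
  linarith

theorem SubLinear.w_le_visits (h : N.SubLinear τ s x z y) (hy : ∀ a, 0 ≤ y a) (hx : 0 ≤ x)
    (p : Request) (i : Station) :
    (compactOfSub y).w p i ≤ visitSum y (fun e => if e.1 = i then 1 else 0) :=
  h.pickSum_le hy hx p i (fun _ => 1) fun _ _ _ => zero_le_one

theorem SubLinear.visitTime_le (hy : ∀ a, 0 ≤ y a) (i : Station) :
    (compactOfSub y).visitTime i ≤
      N.Tend τ * visitSum y (fun e => if e.1 = i then 1 else 0) := by
  rw [← visitSum_const_mul]
  refine visitSum_mono hy fun e _ h2 => ?_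
  split_ifs <;> simp [h2]

theorem SubLinear.picks_le_visitTime (h : N.SubLinear τ s x z y) (hy : ∀ a, 0 ≤ y a) (hx : 0 ≤ x)
    (p : Request) (i : Station) :
    pickSum y p (fun e => if e.1 = i then e.2 else 0) ≤ (compactOfSub y).visitTime i :=
  h.pickSum_le hy hx p i (fun t => t) fun _ h _ => h

/-- Domination of pickups by visits, applied to the nonnegative weight `Tend - t`: each unit of
visiting flow without a pickup adds at most `Tend`. -/
theorem SubLinear.visitTime_le_picks (h : N.SubLinear τ s x z y) (hy : ∀ a, 0 ≤ y a)
    (hx : 0 ≤ x) (p : Request) (i : Station) :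
    (compactOfSub y).visitTime i ≤ pickSum y p (fun e => if e.1 = i then e.2 else 0) +
      N.Tend τ * (visitSum y (fun e => if e.1 = i then 1 else 0) - (compactOfSub y).w p i) := by
  have h1 := h.pickSum_le hy hx p i (fun t => N.Tend τ - t) fun _ _ h => sub_nonneg.2 h
  have e : ∀ q : Station × ℝ, (if q.1 = i then N.Tend τ - q.2 else 0) =
      N.Tend τ * (if q.1 = i then 1 else 0) + (-1) * (if q.1 = i then q.2 else 0) := fun q => by
    split_ifs <;> ring
  simp only [e] at h1
  rw [pickSum_add, visitSum_add, pickSum_const_mul, pickSum_const_mul, visitSum_const_mul,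
    visitSum_const_mul] at h1
  simp only [compactOfSub]
  linarith

/-- Split the visits of `i`. Those followed by a move to `j` give arrivals at `j` later by at least
the travel time; the remaining flow has times at most `Tend`. -/
theorem SubLinear.visitTime_travel (h : N.SubLinear τ s x z y) (hy : ∀ a, 0 ≤ y a) (hx : 0 ≤ x)
    (i j : Station) :
    (compactOfSub y).visitTime i + N.tt i j * (compactOfSub y).y i j ≤
      (compactOfSub y).visitTime j + N.Tend τ *
        (visitSum y (fun e => if e.1 = i then 1 else 0) - (compactOfSub y).y i j) := by
  have h1 := h.visitSum_eq fun e => if e.1 = j then e.2 else 0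
  rw [← moveSum_snd] at h1
  have h2 : 0 ≤ x * (if N.ck τ.1 (N.firstCk τ.1) = j then N.T τ (N.firstCk τ.1) else 0) :=
    mul_nonneg hx (by split_ifs; exacts [N.T_nonneg τ _, le_rfl])
  have h3 : moveSum y (fun m => (if m.1.1 = i ∧ m.2.1 = j then m.1.2 else 0) +
      N.tt i j * (if m.1.1 = i ∧ m.2.1 = j then 1 else 0)) ≤
      moveSum y fun m => if m.2.1 = j then m.2.2 else 0 := by
    refine moveSum_mono hy fun m hm1 _ _ hm4 => ?_
    by_cases hi : m.1.1 = i <;> by_cases hj : m.2.1 = j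
    · subst hi hj
      simpa using hm1
    · simp [hj]
    · simpa [hi, hj] using hm4
    · simp [hj]
  have h4 := h.moveSum_fst fun e => if e.1 = i then e.2 else 0
  have h5 := h.moveSum_fst fun e => if e.1 = i then 1 else 0
  have h6 : moveSum y (fun m => (if m.1.1 = i then m.1.2 else 0) +
      N.Tend τ * (if m.1.1 = i ∧ m.2.1 = j then 1 else 0)) ≤
      moveSum y (fun m => (if m.1.1 = i ∧ m.2.1 = j then m.1.2 else 0) +
      N.Tend τ * (if m.1.1 = i then 1 else 0)) := by
    refine moveSum_mono hy fun m _ _ hm3 _ => ?_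
    by_cases hi : m.1.1 = i <;> by_cases hj : m.2.1 = j <;> simp [hi, hj, hm3]
  rw [moveSum_add, moveSum_const_mul] at h3
  rw [moveSum_add, moveSum_add, moveSum_const_mul, moveSum_const_mul] at h6
  simp only [compactOfSub]
  simp only at h1 h4 h5
  -- At the final checkpoint the terminating visits are missing from `h4` and `h5`. Their time is
  -- exactly `Tend`, so the two corrections cancel in `h6`.
  by_cases hi : N.ck τ.1 (N.lastCk τ.1) = i
  · rw [if_pos hi] at h4 h5
    rw [h4, h5] at h6
    linarith
  · rw [if_neg hi] at h4 h5
    rw [h4, h5] at h6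
    linarith

/-- A simple solution of the relaxed subpath formulation yields a solution of the relaxed compact
formulation. -/
theorem SubLinear.compactLinear [Fintype Station] {M : BigM} (hM : N.Dominates M τ)
    (h : N.SubLinear τ s x z y)
    (hy : ∀ a, 0 ≤ y a) (hx : 0 ≤ x) (hx1 : x ≤ 1) (hs : VisitsOnce y) :
    N.CompactLinear τ s M x z (compactOfSub y) := by
  have hF : ∀ i, visitSum y (fun e => if e.1 = i then 1 else 0) ≤ 1 :=
    fun i => (h.visitSum_le hy hx hs i).trans hx1
  have hT := N.Tend_nonneg τ
  have hw : ∀ p i, (compactOfSub y).w p i ≤ 1 := fun p i => (h.w_le_visits hy hx p i).trans (hF i)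
  have hTF : ∀ p i, N.Tend τ * (visitSum y (fun e => if e.1 = i then 1 else 0) -
      (compactOfSub y).w p i) ≤ N.Tend τ * (1 - (compactOfSub y).w p i) := fun p i =>
    mul_le_mul_of_nonneg_left (by linarith [hF i]) hT
  -- Inner stops are not checkpoints, so a checkpoint is visited only as the end of an arc, at its
  -- scheduled time.
  have hv : ∀ k, (compactOfSub y).visitTime (N.ck τ.1 k) = N.T τ k * (compactOfSub y).v k := by
    intro k
    refine Eq.trans ?_ (visitSum_const_mul (y := y) (N.T τ k) _)
    refine weightedSum_congr fun a _ => congrArg List.sum (List.map_congr_left fun e he => ?_)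
    by_cases hk : e.1 = N.ck τ.1 k
    · have : e = (N.ck τ.1 k, N.T τ k) := by
        cases a with
        | travel r c c' h =>
          obtain ⟨mid, hst, hmid⟩ := r.exists_stops_eq
          simp only [Arc.visits, hst] at he
          rw [← List.cons_append, List.dropLast_concat, List.mem_cons] at he
          rcases he with he | he
          · rw [he] at hk ⊢
            rw [N.ck_injective τ.1 hk]
          · exact absurd hk (hmid e he k)
        | terminate c =>
          rw [Arc.visits, List.mem_singleton] at he
          rw [he] at hk ⊢
          rw [← N.ck_injective τ.1 hk, Tend]
      simp [this]
    · simp [hk]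
  have hv1 : ∀ k, (compactOfSub y).v k ≤ 1 := fun k => hF _
  exact
    { flow := fun i _ => by
        rw [h.out_eq, h.inn_eq]
        by_cases h1 : i = N.ck τ.1 (N.firstCk τ.1)
        · simp [h1, N.ck_first_ne_last τ.1]
        · rw [if_neg h1, if_neg h1]
          split_ifs <;> ring
      travel := fun i _ j _ => by
        have h1 := h.visitTime_travel hy hx i j
        have h2 := hF i
        have h3 := hM.travel i j
        have h4 := h.y_le_visits_fst hy hx i j
        have h5 : N.Tend τ * (visitSum y (fun e => if e.1 = i then 1 else 0) -
          (compactOfSub y).y i j) ≤ N.Tend τ * (1 - (compactOfSub y).y i j) :=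
          mul_le_mul_of_nonneg_left (by linarith) hT
        -- The part `1 - y i j` of a unit lacks both the travel time and up to `Tend` of visiting
        -- time; the big-M constant covers both.
        have h6 : (N.tt i j + N.Tend τ) * (1 - (compactOfSub y).y i j) ≤
          M.mTravel * (1 - (compactOfSub y).y i j) :=
          mul_le_mul_of_nonneg_right h3 (by linarith)
        linarith
      assigned := fun p hp => by
        have h1 := pickSum_finset_sum (y := y) p fun _ => 1
        simp only [one_mul] at h1
        refine h1.le.trans (le_trans (le_of_eq ?_) (h.serve p hp))
        refine (Finset.sum_congr rfl fun a _ => ?_)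
        cases a with
        | travel r c c' h' => cases hr : r.pickup p <;> simp [Arc.pick, Arc.Serves, hr]
        | terminate c => simp [Arc.pick, Arc.Serves]
      capacity := by
        refine le_trans (le_of_eq (Finset.sum_congr rfl fun p _ => ?_)) (h.capacity hy)
        exact (pickSum_finset_sum p fun _ => (N.demand p s : ℝ)).trans (by
          rw [← pickSum_const_mul]; simp)
      pickAfterVisit := fun p i _ => by
        have h1 := h.visitTime_le_picks hy hx p i
        have h2 : pickSum y p (fun e => if e.1 = i then e.2 else 0) ≤ (compactOfSub y).pickTime p :=
          pickSum_mono hy fun e _ _ h3 => by split_ifs <;> simp [h3]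
        have h3 := mul_le_mul_of_nonneg_right hM.tend (sub_nonneg.2 (hw p i))
        linarith [hTF p i]
      pickVisited := fun p i _ =>
        (h.w_le_visits hy hx p i).trans (h.visits_le_out_add_inn hy i)
      pickEarliest := fun p i _ => by
        have h1 := h.picks_le_visitTime hy hx p i
        have h2 : N.earliest τ p i * (compactOfSub y).w p i ≤
            pickSum y p (fun e => if e.1 = i then e.2 else 0) := by
          refine (pickSum_const_mul p _ _).ge.trans (pickSum_mono hy fun e h3 _ _ => ?_)
          by_cases hi : e.1 = i
          · subst hi; simpa using h3
          · simp [hi]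
        have h3 := mul_le_mul_of_nonneg_right (hM.earliest p i) (sub_nonneg.2 (hw p i))
        linarith
      pickLatest := fun p i _ => by
        have h1 := h.visitTime_le_picks hy hx p i
        have h2 : pickSum y p (fun e => if e.1 = i then e.2 else 0) ≤
            N.latest τ p i * (compactOfSub y).w p i := by
          refine le_trans (pickSum_mono hy fun e _ h3 _ => ?_) (pickSum_const_mul p _ _).le
          by_cases hi : e.1 = i
          · subst hi; simpa using h3
          · simp [hi]
        have h3 := mul_le_mul_of_nonneg_right (hM.latest p i) (sub_nonneg.2 (hw p i))
        linarith [hTF p i]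
      sched_ge := fun k => by
        rw [hv]
        have h1 := mul_le_mul_of_nonneg_right ((N.T_le_Tend τ k).trans hM.sched)
          (sub_nonneg.2 (hv1 k))
        linarith
      sched_le := fun k => by
        rw [hv]
        have h1 := mul_le_mul_of_nonneg_right (hT.trans hM.sched) (sub_nonneg.2 (hv1 k))
        have h2 := mul_le_mul_of_nonneg_left (hv1 k) (N.T_nonneg τ k)
        linarith
      stopVisited := fun i _ => by
        have h1 := SubLinear.visitTime_le hy i
        have h2 := h.visits_le_out_add_inn hy i
        refine h1.trans ((mul_le_mul_of_nonneg_left h2 hT).trans ?_)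
        exact mul_le_mul_of_nonneg_right hM.visit (add_nonneg (compactOfSub_out_nonneg hy i)
          (compactOfSub_inn_nonneg hy i))
      ckVisited := fun k => h.visits_le_out_add_inn hy _
      ckOut := fun k j _ => h.y_le_visits_fst hy hx _ j
      ckIn := fun k j _ => h.y_le_visits_snd hy hx j _
      skip := fun k hk => h.le_window hy k hk
      visitTime_nonneg := fun i => visitSum_nonneg hy fun e h1 _ => by
        split_ifs
        exacts [h1, le_rfl]
      pickTime_nonneg := fun p => pickSum_nonneg hy fun e h1 => h1 }

theorem subObj_eq_pickSum (y : N.Arc τ s →₀ ℝ) :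
    N.subObj τ s y = ∑ p, (N.demand p s : ℝ) *
      pickSum y p fun e => N.unitCost τ p e.1 e.2 := by
  simp only [pickSum, ← weightedSum_const_mul]
  rw [← weightedSum_finset_sum, subObj, weightedSum_eq_sum y _ Arc.cost fun a r => mul_comm _ _]
  refine weightedSum_congr fun a _ => ?_
  cases a with
  | travel r c c' h =>
    refine Finset.sum_congr rfl fun p _ => ?_
    cases hr : r.pickup p <;> simp [Arc.pick, hr]
  | terminate c => simp [Arc.cost, Arc.pick]

/-- The cost of a pickup is a function of its location plus a multiple of its time. The location
part is recovered from `w` and the time part from `pickTime`, so the equality is exact for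
fractional flows too. -/
theorem compactObj_compactOfSub [Fintype Station] (y : N.Arc τ s →₀ ℝ) :
    N.compactObj τ s (compactOfSub y) = N.subObj τ s y := by
  rw [subObj_eq_pickSum, compactObj]
  refine Finset.sum_congr rfl fun p _ => congrArg _ ?_
  have h1 := pickSum_finset_sum (y := y) p fun _ => 1
  simp only [one_mul] at h1
  have h2 := pickSum_finset_sum (y := y) p fun i => N.walk i p
  have h3 := pickSum_finset_sum (y := y) p fun i => N.tauReq p + N.walk i p
  simp only [compactOfSub]
  rw [h1, h2, h3]
  have h4 : ∀ e : Station × ℝ, N.unitCost τ p e.1 e.2 =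
      N.lam * N.walk e.1 p + (N.mu * e.2 + (-N.mu * (N.tauReq p + N.walk e.1 p) +
        (N.sigma / N.tauDir p * N.Tend τ * 1 + (-(N.sigma / N.tauDir p) * e.2 +
        (N.delta * (N.late τ p / N.tauDir p) + N.delta / 2 * (N.early τ p / N.tauDir p) -
          N.reward) * 1)))) := fun e => by
    rw [unitCost]
    ring
  simp only [h4]
  simp only [pickSum_add, pickSum_const_mul]
  ring

theorem SubRelaxed.exists_compactRelaxed [Fintype Station] {M : BigM} (hM : N.Dominates M τ)
    (h : N.SubRelaxed τ s x z y) (hx : 0 ≤ x) (hx1 : x ≤ 1) (hs : VisitsOnce y) :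
    ∃ c, N.CompactRelaxed τ s M x z c ∧ N.compactObj τ s c = N.subObj τ s y := by
  have hy : ∀ a, 0 ≤ y a := fun a => (h.2 a).1
  have hF : ∀ i, visitSum y (fun e => if e.1 = i then 1 else 0) ≤ 1 :=
    fun i => (h.1.visitSum_le hy hx hs i).trans hx1
  refine ⟨compactOfSub y, ⟨h.1.compactLinear hM hy hx hx1 hs, fun k => ⟨?_, hF _⟩,
    fun i j => ⟨compactOfSub_y_nonneg hy i j, (h.1.y_le_visits_fst hy hx i j).trans (hF i)⟩,
    fun p i => ⟨?_, (h.1.w_le_visits hy hx p i).trans (hF i)⟩⟩, compactObj_compactOfSub y⟩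
  · exact visitSum_nonneg hy fun e _ _ => by split_ifs <;> norm_num
  · exact pickSum_nonneg hy fun e _ => by split_ifs <;> norm_num

theorem SubFeasible.relaxed (h : N.SubFeasible τ s x z y) : N.SubRelaxed τ s x z y :=
  ⟨h.1, fun a => by rcases h.2 a with h | h <;> rw [h] <;> norm_num⟩

theorem isBinary_of_natCast {r : ℝ} (h : ∃ n : ℕ, r = n) (h1 : r ≤ 1) : IsBinary r := by
  obtain ⟨n, rfl⟩ := h
  have : n ≤ 1 := by exact_mod_cast h1
  interval_cases n
  · exact Or.inl (by simp)
  · exact Or.inr (by simp)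

theorem SubFeasible.exists_compactFeasible [Fintype Station] {M : BigM} (hM : N.Dominates M τ)
    (h : N.SubFeasible τ s x z y) (hx : IsBinary x) (hs : VisitsOnce y) :
    ∃ c, N.CompactFeasible τ s M x z c ∧ N.compactObj τ s c = N.subObj τ s y := by
  have hy : ∀ a, 0 ≤ y a := fun a => (h.relaxed.2 a).1
  have hn : ∀ a, ∃ n : ℕ, y a = n := fun a => by
    rcases h.2 a with h | h
    · exact ⟨0, by simp [h]⟩
    · exact ⟨1, by simp [h]⟩
  have hx0 : 0 ≤ x := by rcases hx with h | h <;> norm_num [h]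
  have hx1 : x ≤ 1 := by rcases hx with h | h <;> norm_num [h]
  have hF : ∀ i, visitSum y (fun e => if e.1 = i then 1 else 0) ≤ 1 :=
    fun i => (h.1.visitSum_le hy hx0 hs i).trans hx1
  refine ⟨compactOfSub y, ⟨h.1.compactLinear hM hy hx0 hx1 hs, fun k =>
    isBinary_of_natCast ?_ (hF _), fun i j => isBinary_of_natCast ?_
    ((h.1.y_le_visits_fst hy hx0 i j).trans (hF i)), fun p i => isBinary_of_natCast ?_
    ((h.1.w_le_visits hy hx0 p i).trans (hF i))⟩, compactObj_compactOfSub y⟩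
  · exact weightedSum_eq_natCast hn fun a => List.sum_map_indicator_eq_natCast _ _
  · exact weightedSum_eq_natCast hn fun a => List.sum_map_indicator_eq_natCast _ _
  · refine weightedSum_eq_natCast hn fun a => ?_
    cases a.pick p with
    | none => exact ⟨0, by simp⟩
    | some e =>
      by_cases he : e.1 = i
      · exact ⟨1, by simp [he]⟩
      · exact ⟨0, by simp [he]⟩

end

end

end MiND

/-! ### Flows that increase a rank -/

theorem List.sum_map_dropLast_sub_tail {α : Type*} (l : List α) (f : α → ℝ) (a b : α)
    (ha : l.head? = some a) (hb : l.getLast? = some b) :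
    (l.dropLast.map f).sum - (l.tail.map f).sum = f a - f b := by
  cases l with
  | nil => simp at ha
  | cons c l =>
    simp only [head?_cons, Option.some.injEq] at ha
    subst ha
    rcases List.eq_nil_or_concat l with rfl | ⟨m, d, rfl⟩
    · simp only [getLast?_singleton, Option.some.injEq] at hb
      simp [hb]
    · rw [concat_eq_append, ← cons_append, getLast?_append] at hb
      have hb : d = b := by simpa using hb
      rw [concat_eq_append, ← cons_append, dropLast_concat]
      simp only [map_cons, sum_cons, cons_append, tail_cons, map_append, sum_append, map_nil,
        sum_nil, hb]
      ring

section RankedFlow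

variable {V : Type*} [Fintype V] (t : V → ℝ)

/-- Among the edges with positive flow choose one whose tail has the largest `t`. Conservation at
its head gives an edge with positive flow and a later tail. -/
theorem eq_zero_of_circulation {r : V → V → ℝ} (h0 : ∀ i j, 0 ≤ r i j)
    (ht : ∀ i j, 0 < r i j → t i < t j) (hc : ∀ j, ∑ k, r j k = ∑ i, r i j) (i j : V) :
    r i j = 0 := by
  classical
  by_contra hne
  obtain ⟨m, hm, hmax⟩ := Finset.exists_max_image
    (Finset.univ.filter fun m : V × V => 0 < r m.1 m.2) (fun m => t m.1)
    ⟨(i, j), by simpa using lt_of_le_of_ne (h0 i j) (Ne.symm hne)⟩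
  have hm' : 0 < r m.1 m.2 := by simpa using hm
  have h1 : 0 < ∑ k, r m.2 k := by
    rw [hc]
    exact Finset.sum_pos' (fun i _ => h0 i _) ⟨m.1, Finset.mem_univ _, hm'⟩
  obtain ⟨k, -, hk⟩ := Finset.exists_lt_of_sum_lt (s := Finset.univ) (f := fun _ => (0 : ℝ))
    (g := fun k => r m.2 k) (by simpa using h1)
  have h2 := hmax (m.2, k) (by simpa using hk)
  exact absurd (ht _ _ hm') (not_lt.2 h2)

/-- Since `t` increases along edges, one can follow the flow from `a` to `b` without repetition.
Subtracting this path leaves a nonnegative circulation, which vanishes; hence the path contains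
every edge of the flow. -/
theorem exists_path_of_unit_flow [DecidableEq V] {e : V → V → ℝ} (he : ∀ i j, IsBinary (e i j))
    (ht : ∀ i j, e i j = 1 → t i < t j) {a b : V}
    (hab : a ≠ b) (hf : ∀ j, ∑ k, e j k - ∑ i, e i j = (if j = a then 1 else 0) -
      if j = b then 1 else 0) :
    ∃ P : List V, P.head? = some a ∧ P.getLast? = some b ∧ P.IsChain (fun i j => e i j = 1) ∧
      ∀ i j, e i j = 1 → i ∈ P ∧ j ∈ P := by
  have he0 : ∀ i j, 0 ≤ e i j := fun i j => by rcases he i j with h | h <;> norm_num [h]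
  have hpath : ∀ j, (j = b ∨ 0 < ∑ k, e j k) →
      ∃ l : List V, (j :: l).IsChain (fun i j => e i j = 1) ∧ (j :: l).getLast? = some b := by
    classical
    by_contra hbad
    push Not at hbad
    obtain ⟨j₀, hj₀, hj₀'⟩ := hbad
    -- Take a vertex from which `b` cannot be reached with the largest `t`. Its successor along the
    -- flow is later, so it does reach `b`.
    obtain ⟨j, hj, hmax⟩ := Finset.exists_max_image
      (Finset.univ.filter fun j : V => (j = b ∨ 0 < ∑ k, e j k) ∧
        ∀ l : List V, (j :: l).IsChain (fun i j => e i j = 1) → (j :: l).getLast? ≠ some b) t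
      ⟨j₀, by simpa using ⟨hj₀, hj₀'⟩⟩
    obtain ⟨hj1, hj2⟩ := (Finset.mem_filter.1 hj).2
    rcases hj1 with rfl | hj1
    · exact hj2 [] (by simp) (by simp)
    obtain ⟨k, -, hk⟩ := Finset.exists_lt_of_sum_lt (s := Finset.univ) (f := fun _ => (0 : ℝ))
      (g := fun k => e j k) (by simpa using hj1)
    have hk1 : e j k = 1 := (he j k).resolve_left hk.ne'
    have hk2 : k = b ∨ 0 < ∑ k', e k k' := by
      refine or_iff_not_imp_left.2 fun hkb => ?_
      have h1 := hf k
      rw [if_neg hkb] at h1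
      have h2 : e j k ≤ ∑ i, e i k :=
        Finset.single_le_sum (f := fun i => e i k) (fun i _ => he0 i k) (Finset.mem_univ j)
      have h3 : (0 : ℝ) ≤ if k = a then 1 else 0 := by split_ifs <;> norm_num
      linarith
    have hk3 : ∃ l : List V, (k :: l).IsChain (fun i j => e i j = 1) ∧
        (k :: l).getLast? = some b := by
      by_contra hcon
      push Not at hcon
      exact absurd (ht _ _ hk1) (not_lt.2 (hmax k (by simpa using ⟨hk2, hcon⟩)))
    obtain ⟨l, hl1, hl2⟩ := hk3
    exact hj2 (k :: l) (List.isChain_cons_cons.2 ⟨hk1, hl1⟩)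
      (by rw [List.getLast?_cons_cons]; exact hl2)
  have ha : 0 < ∑ k, e a k := by
    have h1 := hf a
    rw [if_pos rfl, if_neg hab] at h1
    have : 0 ≤ ∑ i, e i a := Finset.sum_nonneg fun i _ => he0 i a
    linarith
  obtain ⟨l, hl1, hl2⟩ := hpath a (Or.inr ha)
  set P := a :: l with hP
  have : Trans (fun i j : V => t i < t j) (fun i j : V => t i < t j)
    (fun i j : V => t i < t j) := ⟨fun h h' => lt_trans h h'⟩
  have hnd : P.Nodup := ((hl1.imp fun i j h => ht i j h).pairwise).imp fun h h' => by
    subst h'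
    exact lt_irrefl _ h
  -- `cnt` is the flow of the path `P`; it is at most one because `P` has no repetition.
  let cnt : V → V → ℝ := fun i j =>
    ((P.zip P.tail).map fun m => if m.1 = i ∧ m.2 = j then (1 : ℝ) else 0).sum
  have hfst : ∀ i, ((P.zip P.tail).map fun m => if m.1 = i then (1 : ℝ) else 0).sum =
      (P.dropLast.map fun v => if v = i then 1 else 0).sum := fun i => by
    rw [← List.map_fst_zip_tail, List.map_map]
    rfl
  have hsnd : ∀ j, ((P.zip P.tail).map fun m => if m.2 = j then (1 : ℝ) else 0).sum =
      (P.tail.map fun v => if v = j then 1 else 0).sum := fun j => by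
    conv_rhs => rw [← List.map_snd_zip_tail, List.map_map]
    rfl
  have hcnt1 : ∀ i j, cnt i j ≤ 1 := fun i j => by
    have h1 : cnt i j ≤ ((P.zip P.tail).map fun m => if m.1 = i then (1 : ℝ) else 0).sum :=
      List.sum_le_sum fun m _ => by
        by_cases h : m.1 = i <;> by_cases h' : m.2 = j <;> simp [h, h']
    rw [List.sum_map_indicator_fst, List.map_fst_zip_tail] at h1
    have h2 := List.nodup_iff_count_le_one.1 (hnd.sublist (List.dropLast_sublist P)) i
    exact h1.trans (by exact_mod_cast h2)
  have hmem : ∀ i j, cnt i j ≠ 0 → (i, j) ∈ P.zip P.tail := fun i j h => by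
    by_contra hm
    refine h (List.sum_eq_zero fun v hv => ?_)
    obtain ⟨m, hm', rfl⟩ := List.mem_map.1 hv
    refine if_neg ?_
    rintro ⟨rfl, rfl⟩
    exact hm hm'
  have hr0 : ∀ i j, 0 ≤ e i j - cnt i j := fun i j => by
    by_cases h : cnt i j = 0
    · rw [h, sub_zero]
      exact he0 i j
    · have := hl1.rel_of_mem_zip_tail (hmem i j h)
      simp only at this
      rw [this]
      linarith [hcnt1 i j]
  have hcnt0 : ∀ i j, 0 ≤ cnt i j := fun i j =>
    List.sum_map_nonneg fun m _ => by split_ifs <;> norm_num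
  have hz := eq_zero_of_circulation t hr0
    (fun i j h => ht i j ((he i j).resolve_left fun h0 => by linarith [hcnt0 i j])) fun j => by
      rw [Finset.sum_sub_distrib, Finset.sum_sub_distrib]
      have h1 : ∑ k, cnt j k = (P.dropLast.map fun v => if v = j then 1 else 0).sum := by
        rw [← hfst, List.sum_map_finset_sum]
        refine congrArg List.sum (List.map_congr_left fun m _ => ?_)
        by_cases h : m.1 = j <;> simp [h]
      have h2 : ∑ i, cnt i j = (P.tail.map fun v => if v = j then 1 else 0).sum := by
        rw [← hsnd, List.sum_map_finset_sum]
        refine congrArg List.sum (List.map_congr_left fun m _ => ?_)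
        by_cases h : m.2 = j <;> simp [h]
      have h3 := P.sum_map_dropLast_sub_tail (fun v => if v = j then 1 else 0) a b (by simp [hP]) hl2
      have h4 := hf j
      simp only [eq_comm (a := a), eq_comm (a := b)] at h3
      linarith
  refine ⟨P, by simp [hP], hl2, hl1, fun i j hij => ?_⟩
  have h1 : cnt i j ≠ 0 := by
    have := hz i j
    rw [hij] at this
    linarith
  have h2 := List.of_mem_zip (hmem i j h1)
  exact ⟨h2.1, List.mem_of_mem_tail h2.2⟩

end RankedFlow

namespace MiND

noncomputable section

open Classical

variable {Station : Type u₁} {Line : Type u₂} {Request : Type u₃} {Scenario : Type u₄}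
  [Fintype Scenario] {N : MiND Station Line Request Scenario} {τ : N.Trip} {s : Scenario}

/-! ### From a timed path to a subpath solution -/

/-- A route through near locations that keeps the timetable, with its pickups. -/
structure IsRoute (N : MiND Station Line Request Scenario) (τ : N.Trip) (t : Station → ℝ)
    (pk : Request → Option Station) (u : N.Ck τ) (L : List Station) : Prop where
  last : (N.ck τ.1 u :: L).getLast? = some (N.ck τ.1 (N.lastCk τ.1))
  chain : (N.ck τ.1 u :: L).IsChain fun i j => N.next τ.1 i j ∧ t i + N.tt i j ≤ t j
  near : ∀ i ∈ N.ck τ.1 u :: L, N.Near τ.1 i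
  onTime : ∀ k, N.ck τ.1 k ∈ N.ck τ.1 u :: L → t (N.ck τ.1 k) = N.T τ k
  skip : ∀ k : N.Ck τ, u ≤ k → (k : ℕ) + N.K < N.numCk τ.1 →
    ∃ k' : N.Ck τ, k ≤ k' ∧ (k' : ℕ) ≤ k + N.K ∧ N.ck τ.1 k' ∈ N.ck τ.1 u :: L
  mem_pk : ∀ p i, pk p = some i → i ∈ N.ck τ.1 u :: L
  isPickup : ∀ p i, pk p = some i → N.IsPickup τ p i
  time_pk : ∀ p i, pk p = some i → N.earliest τ p i ≤ t i ∧ t i ≤ N.latest τ p i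
  -- No subpath departs from the final checkpoint, so nothing may be left to pick up once it is
  -- reached.
  pk_last : u = N.lastCk τ.1 → ∀ p, pk p = none

theorem IsRoute.pairwise {t : Station → ℝ} {pk : Request → Option Station} {u : N.Ck τ}
    {L : List Station} (h : IsRoute N τ t pk u L) :
    (N.ck τ.1 u :: L).Pairwise fun i j => t i < t j := by
  have : Trans (fun i j : Station => t i < t j) (fun i j : Station => t i < t j)
    (fun i j : Station => t i < t j) := ⟨fun h h' => lt_trans h h'⟩
  exact (h.chain.imp fun i j h => by linarith [h.2, N.tt_pos _ _ _ h.1]).pairwise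

theorem nodup_of_pairwise_lt {α : Type*} {t : α → ℝ} {l : List α}
    (h : l.Pairwise fun i j => t i < t j) : l.Nodup :=
  h.imp fun h h' => by
    subst h'
    exact lt_irrefl _ h

section

variable [Fintype Request]

/-- A simple unit flow from the node `n` to the sink, in which exactly the pickups `pk` happen, at
the times `t`, and all inner locations lie in `L`. -/
structure IsItinerary (t : Station → ℝ) (pk : Request → Option Station) (L : List Station)
    (n : N.Node τ) (y : N.Arc τ s →₀ ℝ) : Prop where
  binary : ∀ a, IsBinary (y a)
  rank_le : ∀ a, y a ≠ 0 → n.rank ≤ a.start.rank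
  flow : ∀ m, weightedSum y (fun a => if a.start = m then 1 else 0) -
    weightedSum y (fun a => if a.finish = m then 1 else 0) =
      (if m = n then 1 else 0) - if m = .sink then 1 else 0
  serve : ∀ p, weightedSum y (fun a => if a.Serves p then 1 else 0) =
    if (pk p).isSome then 1 else 0
  cost : weightedSum y Arc.cost =
    ∑ p, (pk p).elim 0 fun i => N.demand p s * N.unitCost τ p i (t i)
  nodup : ∀ a, y a ≠ 0 → a.stations.Nodup
  -- Invariant for the induction: a prepended subpath whose inner locations avoid `L` is disjoint
  -- from all arcs already used.
  inner_mem : ∀ a, y a ≠ 0 → ∀ i ∈ a.inner, i ∈ L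
  disjoint : ∀ a b, y a ≠ 0 → y b ≠ 0 → a ≠ b → List.Disjoint a.inner b.inner

theorem exists_isItinerary_terminate (t : Station → ℝ) (c : Fin (N.cap τ.1 + 1)) (L) :
    ∃ y : N.Arc τ s →₀ ℝ, IsItinerary t (fun _ => none) L (.pair (N.lastCk τ.1) c) y := by
  have hne : ∀ a, Finsupp.single (Arc.terminate c : N.Arc τ s) (1 : ℝ) a ≠ 0 →
      a = Arc.terminate c := fun a h => by
    by_contra h'
    exact h (Finsupp.single_eq_of_ne h')
  refine ⟨Finsupp.single (.terminate c) 1, ?_, ?_, ?_, ?_, ?_, ?_, ?_, ?_⟩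
  · intro a
    by_cases h : a = Arc.terminate c
    · exact Or.inr (by simp [h])
    · exact Or.inl (Finsupp.single_eq_of_ne h)
  · intro a h
    rw [hne a h]
    rfl
  · intro m
    simp [weightedSum_single, Arc.start, Arc.finish, eq_comm]
  · intro p
    simp [weightedSum_single, Arc.Serves]
  · simp [weightedSum_single, Arc.cost]
  · intro a h
    rw [hne a h]
    simp [Arc.stations]
  · intro a h
    rw [hne a h]
    simp [Arc.inner, Arc.stations]
  · intro a b h h' hab
    exact absurd ((hne a h).trans (hne b h').symm) hab

/-- Prepend a subpath to an itinerary. -/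
theorem IsItinerary.cons {t : Station → ℝ} {pk pk' : Request → Option Station} {L : List Station}
    (r : N.Subpath τ s) (c c' : Fin (N.cap τ.1 + 1)) (h : (c' : ℕ) = c + r.load)
    {y : N.Arc τ s →₀ ℝ} (hy : IsItinerary t pk' L (.pair r.v c') y)
    (hnd : (r.stops.map Prod.fst).Nodup)
    (hL : ∀ i ∈ (r.stops.map Prod.fst).tail.dropLast, i ∉ L)
    (hpk : ∀ p, (r.pickup p = none ∧ pk' p = pk p) ∨
      ∃ i, r.pickup p = some (i, t i) ∧ pk p = some i ∧ pk' p = none) :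
    ∃ y : N.Arc τ s →₀ ℝ, IsItinerary t pk ((r.stops.map Prod.fst).tail.dropLast ++ L)
      (.pair r.u c) y := by
  set a₀ : N.Arc τ s := .travel r c c' h with ha₀
  -- The used arcs start at rank `v` or later, so the new arc is not among them and its value in the
  -- sum is exactly one.
  have h0 : y a₀ = 0 := by
    by_contra hc
    exact absurd (hy.rank_le _ hc) (not_le.2 r.u_lt_v)
  have hval : ∀ a, (Finsupp.single a₀ 1 + y : N.Arc τ s →₀ ℝ) a ≠ 0 →
      a = a₀ ∨ y a ≠ 0 := fun a ha => by
    by_contra hc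
    push Not at hc
    exact ha (by rw [Finsupp.add_apply, Finsupp.single_eq_of_ne hc.1, hc.2, add_zero])
  refine ⟨Finsupp.single a₀ 1 + y, ?_, ?_, ?_, ?_, ?_, ?_, ?_, ?_⟩
  · intro a
    by_cases ha : a = a₀
    · subst ha
      exact Or.inr (by simp [h0])
    · rw [Finsupp.add_apply, Finsupp.single_eq_of_ne ha, zero_add]
      exact hy.binary a
  · intro a ha
    rcases hval a ha with rfl | ha
    · exact le_rfl
    · exact le_trans (le_of_lt r.u_lt_v) (hy.rank_le a ha)
  · intro m
    have h1 := hy.flow m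
    simp only [weightedSum_add, weightedSum_single, one_mul]
    have h2 : (if a₀.start = m then (1 : ℝ) else 0) =
        if m = Node.pair r.u c then 1 else 0 := by simp [ha₀, Arc.start, eq_comm]
    have h3 : (if a₀.finish = m then (1 : ℝ) else 0) =
        if m = Node.pair r.v c' then 1 else 0 := by simp [ha₀, Arc.finish, eq_comm]
    rw [h2, h3]
    linarith
  · intro p
    rw [weightedSum_add, weightedSum_single, hy.serve p]
    rcases hpk p with ⟨h1, h2⟩ | ⟨i, h1, h2, h3⟩
    · simp [ha₀, Arc.Serves, h1, h2]
    · simp [ha₀, Arc.Serves, h1, h2, h3]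
  · rw [weightedSum_add, weightedSum_single, hy.cost, ha₀, Arc.cost, Subpath.cost, one_mul,
      ← Finset.sum_add_distrib]
    refine Finset.sum_congr rfl fun p _ => ?_
    rcases hpk p with ⟨h1, h2⟩ | ⟨i, h1, h2, h3⟩
    · simp [h1, h2]
    · simp [h1, h2, h3]
  · intro a ha
    rcases hval a ha with rfl | ha
    · exact hnd
    · exact hy.nodup a ha
  · intro a ha i hi
    rcases hval a ha with rfl | ha
    · exact List.mem_append_left _ hi
    · exact List.mem_append_right _ (hy.inner_mem a ha i hi)
  · intro a b ha hb hab
    rcases hval a ha with rfl | ha <;> rcases hval b hb with rfl | hb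
    · exact absurd rfl hab
    · exact fun i hi hi' => hL i hi (hy.inner_mem b hb i hi')
    · exact fun i hi hi' => hL i hi' (hy.inner_mem a ha i hi)
    · exact hy.disjoint a b ha hb hab

/-- Cut the route at the first checkpoint `v` after `u`: the front is a subpath and the rest is a
shorter route from `v`. The bound `n` on the length allows the rest to be shorter by any amount. -/
theorem IsRoute.exists_isItinerary (t : Station → ℝ) (n : ℕ) :
    ∀ (L : List Station) (pk : Request → Option Station) (u : N.Ck τ) (c : Fin (N.cap τ.1 + 1)),
      L.length ≤ n → IsRoute N τ t pk u L →
      (c : ℕ) + ∑ p, (if (pk p).isSome then N.demand p s else 0) ≤ N.cap τ.1 →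
      ∃ y : N.Arc τ s →₀ ℝ, IsItinerary t pk L (.pair u c) y := by
  induction n with
  | zero =>
    intro L pk u c hL h hc
    obtain rfl : L = [] := List.length_eq_zero_iff.1 (Nat.le_zero.1 hL)
    have h1 := h.last
    simp only [List.getLast?_singleton, Option.some.injEq] at h1
    obtain rfl := N.ck_injective τ.1 h1
    obtain rfl : pk = fun _ => none := funext (h.pk_last rfl)
    exact exists_isItinerary_terminate t c []
  | succ n ih =>
    intro L pk u c hL h hc
    by_cases hL0 : L = []
    · exact ih L pk u c (by simp [hL0]) h hc
    obtain ⟨v, inner, rest, hsplit, hin⟩ : ∃ v inner rest, L = inner ++ N.ck τ.1 v :: rest ∧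
        ∀ i ∈ inner, ∀ k, i ≠ N.ck τ.1 k := by
      have hmem : ∃ i ∈ L, decide (∃ k, i = N.ck τ.1 k) = true := by
        refine ⟨N.ck τ.1 (N.lastCk τ.1), ?_, by simp⟩
        have h1 := h.last
        rw [List.getLast?_cons_of_ne_nil hL0] at h1
        exact List.mem_of_getLast? h1
      obtain ⟨i, hi⟩ := Option.isSome_iff_exists.1 (List.find?_isSome.2 hmem)
      obtain ⟨h1, as, bs, h2, h3⟩ := List.find?_eq_some_iff_append.1 hi
      obtain ⟨k, rfl⟩ := of_decide_eq_true h1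
      refine ⟨k, as, bs, h2, fun j hj k' hk' => ?_⟩
      simpa [hk'] using h3 j hj
    subst hsplit
    have hpw := h.pairwise
    have hnd := nodup_of_pairwise_lt hpw
    have hlist : N.ck τ.1 u :: (inner ++ N.ck τ.1 v :: rest) =
        (N.ck τ.1 u :: inner) ++ N.ck τ.1 v :: rest := rfl
    have hTu := h.onTime u (by simp)
    have hTv := h.onTime v (by simp)
    have huv : u < v := by
      have := (List.pairwise_cons.1 hpw).1 (N.ck τ.1 v) (by simp)
      rw [hTu, hTv] at this
      exact (N.T_strictMono τ).lt_iff_lt.1 this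
    have hfront : ∀ k, N.ck τ.1 k ∈ N.ck τ.1 u :: (inner ++ N.ck τ.1 v :: rest) → k ≠ u →
        N.ck τ.1 k ∈ N.ck τ.1 v :: rest := by
      intro k hk hku
      rw [hlist, List.mem_append, List.mem_cons] at hk
      rcases hk with (hk | hk) | hk
      · exact absurd (N.ck_injective τ.1 hk) hku
      · exact absurd rfl (hin _ hk k)
      · exact hk
    have hsuf : (N.ck τ.1 v :: rest).Pairwise fun i j => t i < t j := by
      rw [hlist] at hpw
      exact (List.pairwise_append.1 hpw).2.1
    have hlate : ∀ k, N.ck τ.1 k ∈ N.ck τ.1 u :: (inner ++ N.ck τ.1 v :: rest) → k ≠ u →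
        v ≤ k := by
      intro k hk hku
      have h1 := h.onTime k hk
      rcases List.mem_cons.1 (hfront k hk hku) with h2 | h2
      · exact (N.ck_injective τ.1 h2).ge
      · have h3 := (List.pairwise_cons.1 hsuf).1 _ h2
        rw [h1, hTv] at h3
        exact ((N.T_strictMono τ).lt_iff_lt.1 h3).le
    -- Otherwise the window of `K + 1` checkpoints starting at `u + 1` would end before `v`, yet it
    -- contains a visited checkpoint, and none is visited between `u` and `v`.
    have hskip : (v : ℕ) ≤ u + N.K + 1 := by
      by_contra hcon
      push Not at hcon
      have hv := v.2
      obtain ⟨k', h1, h2, h3⟩ := h.skip ⟨u + 1, by omega⟩ (Fin.le_def.2 (Nat.le_succ _))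
        (by simp only; omega)
      simp only [Fin.le_def] at h1 h2
      have h4 := hlate k' h3 (by rintro rfl; omega)
      rw [Fin.le_def] at h4
      omega
    have hrest : v = N.lastCk τ.1 → rest = [] := by
      intro hv
      by_contra hr
      have h1 := h.last
      rw [hlist, List.getLast?_append, List.getLast?_cons_of_ne_nil hr] at h1
      obtain ⟨w, hw⟩ := Option.ne_none_iff_exists'.1
        (mt List.getLast?_eq_none_iff.1 hr)
      rw [hw, Option.some_or, Option.some.injEq] at h1
      have h2 := (List.pairwise_cons.1 hsuf).1 _ (List.mem_of_getLast? hw)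
      rw [h1, hv] at h2
      exact lt_irrefl _ h2
    let taken : Request → Prop := fun p => ∃ i, pk p = some i ∧
      (i ∈ N.ck τ.1 u :: inner ∨ v = N.lastCk τ.1)
    let pick : Request → Option (Station × ℝ) := fun p =>
      if taken p then (pk p).map fun i => (i, t i) else none
    let pk' : Request → Option Station := fun p => if taken p then none else pk p
    have hpick : ∀ p e, pick p = some e → pk p = some e.1 ∧ e.2 = t e.1 ∧
        (e.1 ∈ N.ck τ.1 u :: inner ∨ v = N.lastCk τ.1) := by
      intro p e he
      by_cases hp : taken p
      · obtain ⟨i, h1, h2⟩ := hp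
        have hp : taken p := ⟨i, h1, h2⟩
        simp only [pick, if_pos hp, h1, Option.map_some, Option.some.injEq] at he
        subst he
        exact ⟨h1, rfl, h2⟩
      · simp [pick, if_neg hp] at he
    have hpick' : ∀ p, (pick p = none ∧ pk' p = pk p) ∨
        ∃ i, pick p = some (i, t i) ∧ pk p = some i ∧ pk' p = none := by
      intro p
      by_cases hp : taken p
      · obtain ⟨i, h1, h2⟩ := hp
        have hp : taken p := ⟨i, h1, h2⟩
        exact Or.inr ⟨i, by simp [pick, hp, h1], h1, by simp [pk', hp]⟩
      · exact Or.inl ⟨by simp [pick, hp], by simp [pk', hp]⟩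
    have hload : ∑ p, (if (pick p).isSome then N.demand p s else 0) +
        ∑ p, (if (pk' p).isSome then N.demand p s else 0) =
        ∑ p, (if (pk p).isSome then N.demand p s else 0) := by
      rw [← Finset.sum_add_distrib]
      refine Finset.sum_congr rfl fun p _ => ?_
      rcases hpick' p with ⟨h1, h2⟩ | ⟨i, h1, h2, h3⟩
      · simp [h1, h2]
      · simp [h1, h2, h3]
    have hchain : ((N.ck τ.1 u :: inner) ++ [N.ck τ.1 v]).IsChain
        fun i j => N.next τ.1 i j ∧ t i + N.tt i j ≤ t j := by
      refine h.chain.prefix ⟨rest, ?_⟩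
      simp
    let r : N.Subpath τ s :=
      { u := u
        v := v
        u_lt_v := huv
        skip := hskip
        stops := ((N.ck τ.1 u :: inner) ++ [N.ck τ.1 v]).map fun i => (i, t i)
        stops_head := by simp [hTu]
        stops_last := by rw [List.map_append, List.getLast?_append]; simp [hTv]
        stops_chain := (List.isChain_map _).2 hchain
        stops_near := by
          intro a ha
          obtain ⟨i, hi, rfl⟩ := List.mem_map.1 ha
          refine h.near i ?_
          simp only [List.mem_append, List.mem_cons, List.not_mem_nil, or_false] at hi ⊢
          tauto
        inner_not_ck := by
          intro a ha
          have ha' : a ∈ inner.map fun i => (i, t i) := by simpa using ha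
          obtain ⟨i, hi, rfl⟩ := List.mem_map.1 ha'
          exact hin i hi
        pickup := pick
        pickup_stop := by
          rintro p ⟨i, θ⟩ he
          obtain ⟨h1, h2, h3⟩ := hpick p _ he
          simp only at h1 h2 h3
          subst h2
          refine List.mem_map_of_mem (f := fun i => (i, t i)) ?_
          rcases h3 with h3 | h3
          · exact List.mem_append_left _ h3
          · have := h.mem_pk p i h1
            rw [hrest h3] at this
            exact this
        pickup_location := fun p e he => h.isPickup p _ (hpick p e he).1
        pickup_time := fun p e he => by
          obtain ⟨h1, h2, -⟩ := hpick p e he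
          rw [h2]
          exact h.time_pk p _ h1
        pickup_end := fun p e he hev => by
          obtain ⟨-, -, h3⟩ := hpick p e he
          refine h3.resolve_left fun h4 => ?_
          rw [hev, List.mem_cons] at h4
          rcases h4 with h4 | h4
          · exact huv.ne' (N.ck_injective τ.1 h4)
          · exact hin _ h4 v rfl
        load_le := by omega }
    have hrl : r.load = ∑ p, (if (pick p).isSome then N.demand p s else 0) := rfl
    have hstations : r.stops.map Prod.fst = (N.ck τ.1 u :: inner) ++ [N.ck τ.1 v] := by
      simp only [r, List.map_map]
      exact List.map_id _
    have hinner : (r.stops.map Prod.fst).tail.dropLast = inner := by simp [hstations]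
    obtain ⟨y, hy⟩ := ih rest pk' v ⟨c + r.load, by omega⟩
      (by simp only [List.length_append, List.length_cons] at hL; omega)
      { last := by
          have h1 := h.last
          rw [hlist, List.getLast?_append] at h1
          simpa using h1
        chain := h.chain.suffix ⟨N.ck τ.1 u :: inner, rfl⟩
        near := fun i hi => h.near i (by rw [hlist]; exact List.mem_append_right _ hi)
        onTime := fun k hk => h.onTime k (by rw [hlist]; exact List.mem_append_right _ hk)
        skip := fun k hk hK => by
          obtain ⟨k', h1, h2, h3⟩ := h.skip k (huv.le.trans hk) hK
          exact ⟨k', h1, h2, hfront k' h3 (huv.trans_le (hk.trans h1)).ne'⟩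
        mem_pk := fun p i hp => by
          have hnt : ¬ taken p := fun ht => by simp [pk', ht] at hp
          simp only [pk', if_neg hnt] at hp
          have h1 := h.mem_pk p i hp
          rw [hlist, List.mem_append] at h1
          exact h1.resolve_left fun h2 => hnt ⟨i, hp, Or.inl h2⟩
        isPickup := fun p i hp => by
          have hnt : ¬ taken p := fun ht => by simp [pk', ht] at hp
          simp only [pk', if_neg hnt] at hp
          exact h.isPickup p i hp
        time_pk := fun p i hp => by
          have hnt : ¬ taken p := fun ht => by simp [pk', ht] at hp
          simp only [pk', if_neg hnt] at hp
          exact h.time_pk p i hp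
        pk_last := fun hv p => by
          cases hp : pk p with
          | none => simp [pk', hp]
          | some i => exact if_pos ⟨i, hp, Or.inr hv⟩ }
      (by simp only; omega)
    obtain ⟨y', hy'⟩ := hy.cons r c _ rfl
      (by
        rw [hstations]
        exact hnd.sublist (by rw [hlist]; exact List.Sublist.append_left (by simp) _))
      (by
        rw [hinner]
        intro i hi hi'
        have h1 := (List.nodup_cons.1 hnd).2
        exact (List.nodup_append.1 h1).2.2 i hi i (List.mem_cons_of_mem _ hi') rfl)
      hpick'
    refine ⟨y', { hy' with inner_mem := fun a ha i hi => ?_ }⟩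
    have h1 := hy'.inner_mem a ha i hi
    rw [hinner, List.mem_append] at h1
    rw [List.mem_append, List.mem_cons]
    tauto

theorem IsItinerary.visitsOnce {t : Station → ℝ} {pk : Request → Option Station} {L : List Station}
    {n : N.Node τ} {y : N.Arc τ s →₀ ℝ} (h : IsItinerary t pk L n y) : VisitsOnce y := by
  refine ⟨h.nodup, fun a b hab => h.disjoint a b ?_ ?_ ?_⟩
  · induction hab with
    | single h => exact h.1
    | tail _ _ ih => exact ih
  · cases hab with
    | single h => exact h.2.1
    | tail _ h => exact h.2.1
  · rintro rfl
    exact lt_irrefl _ (Follows.rank_lt_of_transGen hab)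

theorem IsItinerary.subFeasible {t : Station → ℝ} {pk : Request → Option Station}
    {L : List Station} {y : N.Arc τ s →₀ ℝ} (h : IsItinerary t pk L (N.source τ) y)
    {z : Request → ℝ} (hz : ∀ p, N.Compatible τ p → (if (pk p).isSome then 1 else 0) ≤ z p) :
    N.SubFeasible τ s 1 z y := by
  refine ⟨⟨fun m => ?_, fun p hp => ?_⟩, h.binary⟩
  · rw [weightedSum_eq_sum y _ (fun a => if a.start = m then 1 else 0) fun a r => by simp,
      weightedSum_eq_sum y _ (fun a => if a.finish = m then 1 else 0) fun a r => by simp, h.flow]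
    by_cases h1 : m = N.source τ
    · subst h1
      simp [source]
    · simp [h1]
      split_ifs <;> simp
  · rw [weightedSum_eq_sum y _ (fun a => if a.Serves p then 1 else 0) fun a r => by simp, h.serve]
    exact hz p hp

end

end

end MiND

/-! ### Auxiliary facts on bounded affine functions, minima and chains -/

theorem nonneg_of_forall_le_add_mul {b m S : ℝ} (h : ∀ r : ℝ, 0 ≤ r → b ≤ m + r * S) : 0 ≤ S := by
  by_contra hS
  push Not at hS
  have h0 := h 0 le_rfl
  -- For this `r` the affine function takes the value `b - 1`.
  have h1 := h ((m - b + 1) / -S) (div_nonneg (by linarith) (by linarith))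
  have h2 : (m - b + 1) / -S * S = -(m - b + 1) := by
    have := hS.ne
    field_simp
  rw [h2] at h1
  linarith

/-- Used with the values of compact solutions for `C` and those of simple subpath solutions for `S`.
-/
theorem isLeast_iff_of_subset_of_dominated {C S : Set ℝ} (hS : S ⊆ C)
    (hC : ∀ m ∈ C, ∃ m' ∈ S, m' ≤ m) (m : ℝ) : IsLeast C m ↔ IsLeast S m := by
  constructor
  · rintro ⟨h1, h2⟩
    obtain ⟨m', h3, h4⟩ := hC m h1
    obtain rfl : m' = m := le_antisymm h4 (h2 (hS h3))
    exact ⟨h3, fun a ha => h2 (hS ha)⟩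
  · rintro ⟨h1, h2⟩
    refine ⟨hS h1, fun a ha => ?_⟩
    obtain ⟨m', h3, h4⟩ := hC a ha
    exact (h2 h3).trans h4

theorem List.IsChain.exists_rel_of_mem_tail {α : Type*} {R : α → α → Prop} {l : List α}
    (h : l.IsChain R) {a : α} (ha : a ∈ l.tail) : ∃ b, R b a := by
  rw [← List.map_snd_zip_tail] at ha
  obtain ⟨m, hm, rfl⟩ := List.mem_map.1 ha
  exact ⟨m.1, h.rel_of_mem_zip_tail hm⟩

namespace MiND

noncomputable section

open Classical

variable {Station : Type u₁} {Line : Type u₂} {Request : Type u₃} {Scenario : Type u₄}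
  [Fintype Scenario] {N : MiND Station Line Request Scenario} {τ : N.Trip} {s : Scenario}

/-! ### From the compact formulation to the subpath formulation -/

theorem unitCost_eq_add_mul (N : MiND Station Line Request Scenario) (τ : N.Trip) (p : Request)
    (i : Station) (t : ℝ) : N.unitCost τ p i t =
      N.unitCost τ p i 0 + (N.mu - N.sigma / N.tauDir p) * t := by
  rw [unitCost, unitCost]
  ring

/-- Travel along the allowed moves between near locations. -/
def CompactVars.travel (c : N.CompactVars τ) (i j : Station) : ℝ :=
  -- Outside the allowed moves the compact formulation leaves `y` free, so its values there are
  -- replaced by zero.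
  if N.Near τ.1 i ∧ N.Near τ.1 j ∧ N.next τ.1 i j then c.y i j else 0

theorem CompactVars.out_eq [Fintype Station] (c : N.CompactVars τ)
    {i : Station} (hi : N.Near τ.1 i) :
    c.out i = ∑ j, c.travel i j := by
  simp only [out, succs, travel, hi, true_and, Finset.sum_filter]

theorem CompactVars.inn_eq [Fintype Station] (c : N.CompactVars τ)
    {i : Station} (hi : N.Near τ.1 i) :
    c.inn i = ∑ j, c.travel j i := by
  simp only [inn, preds, travel, hi, true_and, Finset.sum_filter]

theorem CompactVars.travel_eq_one {c : N.CompactVars τ} {i j : Station} (h : c.travel i j = 1) :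
    N.Near τ.1 i ∧ N.Near τ.1 j ∧ N.next τ.1 i j ∧ c.y i j = 1 := by
  rw [travel] at h
  split_ifs at h with h1
  · exact ⟨h1.1, h1.2.1, h1.2.2, h⟩
  · exact absurd h zero_ne_one

/-- The pickup location of a request in a binary compact solution. -/
def CompactVars.pick [Fintype Station] (c : N.CompactVars τ) (p : Request) : Option Station :=
  if h : ∃ i ∈ N.pickupSet τ p, c.w p i = 1 then some h.choose else none

theorem CompactVars.pick_eq_some [Fintype Station]
    {c : N.CompactVars τ} {p : Request} {i : Station} (h : c.pick p = some i) :
    N.IsPickup τ p i ∧ c.w p i = 1 := by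
  rw [pick] at h
  split_ifs at h with h1
  obtain rfl := Option.some.inj h
  exact ⟨by simpa [pickupSet] using h1.choose_spec.1, h1.choose_spec.2⟩

theorem subValuesOnce_subset_subValues [Fintype Request] {x : ℝ} {z : Request → ℝ} :
    N.subValuesOnce τ s x z ⊆ N.subValues τ s x z := by
  rintro m ⟨y, hy, -, rfl⟩
  exact ⟨y, hy, rfl⟩

theorem fullSubValuesOnce_subset_fullSubValues [Fintype Line] [Fintype Request] :
    N.fullSubValuesOnce ⊆ N.fullSubValues := by
  rintro m ⟨x, z, y, h1, h2, -, rfl⟩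
  exact ⟨x, z, y, h1, h2, rfl⟩

section

variable [Fintype Station] [Fintype Request]

/-- Isolates the coefficient `mu - sigma / tauDir` of the pickup time, on whose sign boundedness
rests. -/
theorem compactObj_eq (c : N.CompactVars τ) : N.compactObj τ s c =
    ∑ p, (N.demand p s : ℝ) * (∑ i ∈ N.pickupSet τ p, N.unitCost τ p i 0 * c.w p i +
      (N.mu - N.sigma / N.tauDir p) * c.pickTime p) := by
  refine Finset.sum_congr rfl fun p _ => congrArg _ ?_
  have h : ∀ i, N.unitCost τ p i 0 * c.w p i = N.lam * (N.walk i p * c.w p i) +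
      (-N.mu) * ((N.tauReq p + N.walk i p) * c.w p i) +
      (N.sigma / N.tauDir p * N.Tend τ + (N.delta * (N.late τ p / N.tauDir p) +
        N.delta / 2 * (N.early τ p / N.tauDir p)) - N.reward) * c.w p i := fun i => by
    rw [unitCost]
    ring
  simp only [h, Finset.sum_add_distrib, ← Finset.mul_sum]
  ring

variable {M : BigM} {x : ℝ} {z : Request → ℝ} {c : N.CompactVars τ}

theorem CompactFeasible.travel_binary (h : N.CompactFeasible τ s M x z c) (i j : Station) :
    IsBinary (c.travel i j) := by
  rw [CompactVars.travel]
  split_ifs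
  · exact h.2.2.1 i j
  · exact Or.inl rfl

theorem CompactFeasible.visitTime_add_le (h : N.CompactFeasible τ s M x z c) {i j : Station}
    (hij : c.travel i j = 1) : c.visitTime i + N.tt i j ≤ c.visitTime j := by
  obtain ⟨h1, h2, h3, h4⟩ := CompactVars.travel_eq_one hij
  have := h.1.travel i h1 j (by simp [succs, h2, h3])
  rw [h4] at this
  linarith

theorem CompactFeasible.visitTime_lt (h : N.CompactFeasible τ s M x z c) {i j : Station}
    (hij : c.travel i j = 1) : c.visitTime i < c.visitTime j := by
  have h1 := h.visitTime_add_le hij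
  have h2 := N.tt_pos _ _ _ (CompactVars.travel_eq_one hij).2.2.1
  linarith

theorem CompactFeasible.balance (h : N.CompactFeasible τ s M x z c) (i : Station) :
    ∑ j, c.travel i j - ∑ j, c.travel j i =
      if i = N.ck τ.1 (N.firstCk τ.1) then x else if i = N.ck τ.1 (N.lastCk τ.1) then -x else 0 := by
  by_cases hi : N.Near τ.1 i
  · rw [← c.out_eq hi, ← c.inn_eq hi, h.1.flow i hi]
  · have h1 : ∀ k, i ≠ N.ck τ.1 k := by
      rintro k rfl
      exact hi (N.ck_near τ.1 k)
    simp [CompactVars.travel, hi, h1]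

theorem CompactFeasible.exists_travel (h : N.CompactFeasible τ s M x z c) {i : Station}
    (hi : N.Near τ.1 i) (hpos : 0 < c.out i + c.inn i) :
    ∃ j, c.travel i j = 1 ∨ c.travel j i = 1 := by
  by_contra hcon
  push Not at hcon
  have h1 : ∀ j, c.travel i j = 0 := fun j => (h.travel_binary i j).resolve_right (hcon j).1
  have h2 : ∀ j, c.travel j i = 0 := fun j => (h.travel_binary j i).resolve_right (hcon j).2
  rw [c.out_eq hi, c.inn_eq hi] at hpos
  simp [h1, h2] at hpos

/-- Two pickup locations with `w = 1` would exceed `z p ≤ 1`, so the chosen location is the only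
one. -/
theorem CompactFeasible.w_eq (h : N.CompactFeasible τ s M x z c) (hz : ∀ p, IsBinary (z p))
    (p : Request) {i : Station} (hi : i ∈ N.pickupSet τ p) :
    c.w p i = if c.pick p = some i then 1 else 0 := by
  have hp : N.Compatible τ p := by
    have : N.IsPickup τ p i := by simpa [pickupSet] using hi
    exact this.1
  split_ifs with h1
  · exact (CompactVars.pick_eq_some h1).2
  · refine (h.2.2.2 p i).resolve_right fun hw => ?_
    have hex : ∃ i ∈ N.pickupSet τ p, c.w p i = 1 := ⟨i, hi, hw⟩
    have hne : hex.choose ≠ i := fun he => h1 (by rw [CompactVars.pick, dif_pos hex, he])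
    have h2 := h.1.assigned p hp
    have h3 : ∑ j ∈ {hex.choose, i}, c.w p j ≤ ∑ j ∈ N.pickupSet τ p, c.w p j := by
      refine Finset.sum_le_sum_of_subset_of_nonneg ?_ fun j _ _ => ?_
      · intro j hj
        rw [Finset.mem_insert, Finset.mem_singleton] at hj
        rcases hj with rfl | rfl
        exacts [hex.choose_spec.1, hi]
      · rcases h.2.2.2 p j with h | h <;> norm_num [h]
    rw [Finset.sum_pair hne, hw, hex.choose_spec.2] at h3
    have h4 : z p ≤ 1 := by rcases hz p with h | h <;> norm_num [h]
    linarith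

theorem CompactFeasible.sum_mul_w (h : N.CompactFeasible τ s M x z c) (hz : ∀ p, IsBinary (z p))
    (p : Request) (g : Station → ℝ) :
    ∑ i ∈ N.pickupSet τ p, g i * c.w p i = (c.pick p).elim 0 g := by
  rw [Finset.sum_congr rfl fun i hi => by rw [h.w_eq hz p hi]]
  cases hp : c.pick p with
  | none => simp
  | some i =>
    have : i ∈ N.pickupSet τ p := by simpa [pickupSet] using (CompactVars.pick_eq_some hp).1
    simp [this]

theorem CompactFeasible.travel_eq_zero (h : N.CompactFeasible τ s M 0 z c) (i j : Station) :
    c.travel i j = 0 := by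
  refine eq_zero_of_circulation c.visitTime (fun i j => ?_) (fun i j hij => ?_) (fun j => ?_) i j
  · rcases h.travel_binary i j with h | h <;> norm_num [h]
  · exact h.visitTime_lt ((h.travel_binary i j).resolve_left hij.ne')
  · have := h.balance j
    simp only [neg_zero, ite_self] at this
    linarith

/-- The flow is a single path, ordered by `visitTime`. A location touched by the flow lies on the
path, and this covers the pickup locations and the checkpoints counted by `v`. -/
theorem CompactFeasible.isRoute (h : N.CompactFeasible τ s M 1 z c) :
    ∃ L, N.IsRoute τ c.visitTime c.pick (N.firstCk τ.1) L := by
  obtain ⟨P, hP1, hP2, hP3, hP4⟩ := exists_path_of_unit_flow c.visitTime h.travel_binary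
    (fun i j hij => h.visitTime_lt hij) (N.ck_first_ne_last τ.1) fun j => by
      rw [h.balance j]
      by_cases h1 : j = N.ck τ.1 (N.firstCk τ.1)
      · simp [h1, N.ck_first_ne_last τ.1]
      · by_cases h2 : j = N.ck τ.1 (N.lastCk τ.1) <;> simp [h1, h2, (N.ck_first_ne_last τ.1).symm]
  obtain ⟨L, rfl⟩ : ∃ L, P = N.ck τ.1 (N.firstCk τ.1) :: L := by
    cases P with
    | nil => simp at hP1
    | cons a L =>
      rw [List.head?_cons, Option.some.injEq] at hP1
      exact ⟨L, by rw [hP1]⟩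
  have hmem : ∀ i, N.Near τ.1 i → 0 < c.out i + c.inn i → i ∈ N.ck τ.1 (N.firstCk τ.1) :: L := by
    intro i hi hpos
    obtain ⟨j, hj | hj⟩ := h.exists_travel hi hpos
    · exact (hP4 i j hj).1
    · exact (hP4 j i hj).2
  -- Every location on the path is touched by the flow, so checkpoints on it have `v = 1` and are
  -- met on schedule.
  have hedge : ∀ i ∈ N.ck τ.1 (N.firstCk τ.1) :: L, ∃ j, c.travel i j = 1 ∨ c.travel j i = 1 := by
    intro i hi
    rcases List.mem_cons.1 hi with rfl | hi
    · have h1 := h.1.flow _ (N.ck_near τ.1 (N.firstCk τ.1))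
      rw [if_pos rfl] at h1
      have h2 : 0 ≤ c.inn (N.ck τ.1 (N.firstCk τ.1)) := Finset.sum_nonneg fun j _ => by
        rcases h.2.2.1 j (N.ck τ.1 (N.firstCk τ.1)) with h | h <;> norm_num [h]
      exact h.exists_travel (N.ck_near τ.1 _) (by linarith)
    · obtain ⟨j, hj⟩ := hP3.exists_rel_of_mem_tail hi
      exact ⟨j, Or.inr hj⟩
  refine ⟨L, ?_, ?_, ?_, ?_, ?_, ?_, ?_, ?_, ?_⟩
  · exact hP2
  · exact hP3.imp fun i j hij => ⟨(CompactVars.travel_eq_one hij).2.2.1, h.visitTime_add_le hij⟩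
  · intro i hi
    obtain ⟨j, hj | hj⟩ := hedge i hi
    · exact (CompactVars.travel_eq_one hj).1
    · exact (CompactVars.travel_eq_one hj).2.1
  · intro k hk
    have hv : c.v k = 1 := by
      refine (h.2.1 k).resolve_left fun hv => ?_
      obtain ⟨j, hj | hj⟩ := hedge _ hk
      · obtain ⟨-, h2, h3, h4⟩ := CompactVars.travel_eq_one hj
        have := h.1.ckOut k j (by simp [succs, h2, h3])
        linarith
      · obtain ⟨h2, -, h3, h4⟩ := CompactVars.travel_eq_one hj
        have := h.1.ckIn k j (by simp [preds, h2, h3])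
        linarith
    have h1 := h.1.sched_ge k
    have h2 := h.1.sched_le k
    rw [hv] at h1 h2
    linarith
  · intro k _ hk
    have h1 := h.1.skip k hk
    obtain ⟨k', -, hk'⟩ := Finset.exists_lt_of_sum_lt (s := Finset.univ) (f := fun _ => (0 : ℝ))
      (lt_of_lt_of_le (by simp) h1)
    split_ifs at hk' with hw
    · exact ⟨k', hw.1, hw.2, hmem _ (N.ck_near τ.1 k') (hk'.trans_le (h.1.ckVisited k'))⟩
    · exact absurd hk' (lt_irrefl _)
  · intro p i hp
    obtain ⟨h1, h2⟩ := CompactVars.pick_eq_some hp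
    have h3 := h.1.pickVisited p i (by simpa [pickupSet] using h1)
    rw [h2] at h3
    exact hmem i h1.2.1 (by linarith)
  · exact fun p i hp => (CompactVars.pick_eq_some hp).1
  · intro p i hp
    obtain ⟨h1, h2⟩ := CompactVars.pick_eq_some hp
    have h3 := h.1.pickEarliest p i (by simpa [pickupSet] using h1)
    have h4 := h.1.pickLatest p i (by simpa [pickupSet] using h1)
    rw [h2] at h3 h4
    constructor <;> linarith
  · exact fun hl => absurd hl (N.firstCk_ne_lastCk τ.1)

/-- A binary compact solution yields a simple subpath solution; the objectives differ by the
cost of the time that elapses between the visits and the pickups. -/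
theorem CompactFeasible.exists_subFeasible (h : N.CompactFeasible τ s M x z c) (hx : IsBinary x)
    (hz : ∀ p, IsBinary (z p)) :
    ∃ (y : N.Arc τ s →₀ ℝ) (δ : Request → ℝ), N.SubFeasible τ s x z y ∧ VisitsOnce y ∧
      (∀ p, 0 ≤ δ p) ∧ N.compactObj τ s c = N.subObj τ s y +
        ∑ p, (N.demand p s : ℝ) * ((N.mu - N.sigma / N.tauDir p) * δ p) := by
  have hsum := h.sum_mul_w hz
  rcases hx with rfl | rfl
  · have hpk : ∀ p, c.pick p = none := by
      intro p
      cases hp : c.pick p with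
      | none => rfl
      | some i =>
        obtain ⟨h1, h2⟩ := CompactVars.pick_eq_some hp
        have h3 := h.1.pickVisited p i (by simpa [pickupSet] using h1)
        rw [h2, c.out_eq h1.2.1, c.inn_eq h1.2.1] at h3
        simp only [h.travel_eq_zero, Finset.sum_const_zero] at h3
        norm_num at h3
    -- With `x = 0` nothing travels and nothing is picked up, but free values of `pickTime` still
    -- count in the objective; they form `δ`.
    refine ⟨0, c.pickTime, ⟨⟨fun n => by simp, fun p _ => ?_⟩, fun a => Or.inl rfl⟩,
      ⟨fun a ha => absurd rfl ha, fun a b hab => ?_⟩, h.1.pickTime_nonneg, ?_⟩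
    · rw [Finsupp.sum_zero_index]
      rcases hz p with h | h <;> norm_num [h]
    · cases hab with
      | single h => exact absurd rfl h.1
      | tail _ h => exact absurd rfl h.1
    · rw [compactObj_eq, subObj, Finsupp.sum_zero_index, zero_add]
      refine Finset.sum_congr rfl fun p _ => ?_
      rw [hsum, hpk p, Option.elim_none, zero_add]
  · obtain ⟨L, hL⟩ := h.isRoute
    have hserve : ∀ p, N.Compatible τ p → (if (c.pick p).isSome then (1 : ℝ) else 0) ≤ z p := by
      intro p hp
      refine le_trans (le_of_eq ?_) (h.1.assigned p hp)
      have h1 := hsum p fun _ => 1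
      simp only [one_mul] at h1
      rw [h1]
      cases c.pick p <;> simp
    have hload : ∑ p, (if (c.pick p).isSome then N.demand p s else 0) ≤ N.cap τ.1 := by
      have h1 := h.1.capacity
      rw [mul_one] at h1
      have h2 : ∀ p, ∑ i ∈ N.pickupSet τ p, (N.demand p s : ℝ) * c.w p i =
          ((if (c.pick p).isSome then N.demand p s else 0 : ℕ) : ℝ) := fun p => by
        rw [hsum p fun _ => (N.demand p s : ℝ)]
        cases c.pick p <;> simp
      simp only [h2] at h1
      exact_mod_cast h1
    obtain ⟨y, hy⟩ := IsRoute.exists_isItinerary (s := s) c.visitTime L.length L c.pick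
      (N.firstCk τ.1) 0 le_rfl hL (by simpa using hload)
    -- The delay is measured from the visit of the pickup location, and from time `0` for a request
    -- that is not picked up.
    refine ⟨y, fun p => c.pickTime p - (c.pick p).elim 0 c.visitTime, hy.subFeasible hserve,
      hy.visitsOnce, fun p => ?_, ?_⟩
    · dsimp only
      cases hp : c.pick p with
      | none => simpa using h.1.pickTime_nonneg p
      | some i =>
        obtain ⟨h1, h2⟩ := CompactVars.pick_eq_some hp
        have h3 := h.1.pickAfterVisit p i h1.2.1
        rw [h2] at h3
        simp only [Option.elim_some]
        linarith
    · rw [compactObj_eq, subObj, weightedSum_eq_sum y _ Arc.cost fun a r => mul_comm _ _, hy.cost,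
        ← Finset.sum_add_distrib]
      refine Finset.sum_congr rfl fun p _ => ?_
      rw [hsum]
      dsimp only
      cases c.pick p with
      | none => simp
      | some i =>
        simp only [Option.elim_some]
        rw [unitCost_eq_add_mul N τ p i (c.visitTime i)]
        ring

/-! ### Postponed pickups -/

/-- Increase the pickup times. -/
def CompactVars.postpone (c : N.CompactVars τ) (δ : Request → ℝ) : N.CompactVars τ :=
  { c with pickTime := fun p => c.pickTime p + δ p }

/-- All constraints bound `pickTime` from below only. -/
theorem CompactFeasible.postpone (h : N.CompactFeasible τ s M x z c) {δ : Request → ℝ}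
    (hδ : ∀ p, 0 ≤ δ p) : N.CompactFeasible τ s M x z (c.postpone δ) :=
  ⟨{ h.1 with
      pickAfterVisit := fun p i hi => (h.1.pickAfterVisit p i hi).trans
        (le_add_of_nonneg_right (hδ p))
      pickTime_nonneg := fun p => add_nonneg (h.1.pickTime_nonneg p) (hδ p) }, h.2⟩

theorem compactObj_postpone (c : N.CompactVars τ) (r : ℝ) (δ : Request → ℝ) :
    N.compactObj τ s (c.postpone fun p => r * δ p) = N.compactObj τ s c +
      r * ∑ p, (N.demand p s : ℝ) * ((N.mu - N.sigma / N.tauDir p) * δ p) := by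
  rw [compactObj_eq, compactObj_eq, Finset.mul_sum, ← Finset.sum_add_distrib]
  refine Finset.sum_congr rfl fun p _ => ?_
  simp only [CompactVars.postpone]
  ring

/-! ### Equivalence in the second stage -/

/-- Postponing by `r * δ` changes the objective by `r` times its excess over the subpath value.
Boundedness below for all `r ≥ 0` makes that excess nonnegative. -/
theorem CompactFeasible.exists_sub_le (h : N.CompactFeasible τ s M x z c) (hx : IsBinary x)
    (hz : ∀ p, IsBinary (z p)) (hb : BddBelow (N.compactValues τ s M x z)) :
    ∃ y, N.SubFeasible τ s x z y ∧ VisitsOnce y ∧ N.subObj τ s y ≤ N.compactObj τ s c := by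
  obtain ⟨y, δ, h1, h2, h3, h4⟩ := h.exists_subFeasible hx hz
  obtain ⟨b, hb⟩ := hb
  refine ⟨y, h1, h2, ?_⟩
  have := nonneg_of_forall_le_add_mul fun r hr => by
    rw [← compactObj_postpone (s := s) c r δ]
    exact hb ⟨_, h.postpone fun p => mul_nonneg hr (h3 p), rfl⟩
  linarith

theorem subValuesOnce_subset (hM : N.Dominates M τ) (hx : IsBinary x) :
    N.subValuesOnce τ s x z ⊆ N.compactValues τ s M x z := by
  rintro m ⟨y, hy, hs, rfl⟩
  obtain ⟨c, hc, he⟩ := hy.exists_compactFeasible hM hx hs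
  exact ⟨c, hc, he.symm⟩

theorem isLeast_compactValues_iff (hM : N.Dominates M τ) (hx : IsBinary x)
    (hz : ∀ p, IsBinary (z p)) (hb : BddBelow (N.compactValues τ s M x z)) (m : ℝ) :
    IsLeast (N.compactValues τ s M x z) m ↔ IsLeast (N.subValuesOnce τ s x z) m := by
  refine isLeast_iff_of_subset_of_dominated (subValuesOnce_subset hM hx) ?_ m
  rintro m ⟨c, hc, rfl⟩
  obtain ⟨y, h1, h2, h3⟩ := hc.exists_sub_le hx hz hb
  exact ⟨_, ⟨y, h1, h2, rfl⟩, h3⟩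

/-- An optimal solution provides the lower bound needed for one inequality; the subpath solution
transferred back to the compact formulation gives the other. -/
theorem CompactOptimal.exists_sub_eq (hM : N.Dominates M τ) (h : N.CompactOptimal τ s M x z c)
    (hx : IsBinary x) (hz : ∀ p, IsBinary (z p)) :
    ∃ y, N.SubFeasible τ s x z y ∧ VisitsOnce y ∧ N.subObj τ s y = N.compactObj τ s c := by
  have hlb : N.compactObj τ s c ∈ lowerBounds (N.compactValues τ s M x z) := by
    rintro m ⟨c', hc', rfl⟩
    exact h.2 c' hc'
  obtain ⟨y, h1, h2, h3⟩ := h.1.exists_sub_le hx hz ⟨_, hlb⟩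
  exact ⟨y, h1, h2, le_antisymm h3 (hlb (subValuesOnce_subset hM hx ⟨y, h1, h2, rfl⟩))⟩

/-! ### Boundedness -/

theorem exists_le_compactObj (N : MiND Station Line Request Scenario) (τ : N.Trip) (s : Scenario)
    (hσ : ∀ p, N.sigma ≤ N.mu * N.tauDir p) :
    ∃ b, ∀ (M : BigM) (x : ℝ) (z : Request → ℝ) (c : N.CompactVars τ),
      N.CompactFeasible τ s M x z c → b ≤ N.compactObj τ s c := by
  refine ⟨∑ p, (N.demand p s : ℝ) * ∑ i ∈ N.pickupSet τ p, -|N.unitCost τ p i 0|,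
    fun M x z c h => ?_⟩
  rw [compactObj_eq]
  refine Finset.sum_le_sum fun p _ => mul_le_mul_of_nonneg_left ?_ (Nat.cast_nonneg _)
  have h1 : 0 ≤ (N.mu - N.sigma / N.tauDir p) * c.pickTime p := by
    refine mul_nonneg (sub_nonneg.2 ?_) (h.1.pickTime_nonneg p)
    rw [div_le_iff₀ (N.tauDir_pos p)]
    exact hσ p
  refine le_add_of_le_of_nonneg (Finset.sum_le_sum fun i _ => ?_) h1
  rcases h.2.2.2 p i with hw | hw
  · rw [hw, mul_zero]
    exact neg_nonpos.2 (abs_nonneg _)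
  · rw [hw, mul_one]
    exact neg_abs_le _

end

/-! ### The two-stage models -/

section

variable [Fintype Station] [Fintype Line] [Fintype Request] {M : BigM}

theorem fullSubValuesOnce_subset (hM : ∀ τ, N.Dominates M τ) :
    N.fullSubValuesOnce ⊆ N.fullCompactValues M := by
  rintro m ⟨x, z, y, h1, h2, h3, rfl⟩
  choose c hc he using fun τ s => (h2 τ s).exists_compactFeasible (hM τ) (h1.x_binary τ) (h3 τ s)
  exact ⟨x, z, c, h1, hc, by simp only [he]⟩

/-- Only the total objective is known to be bounded below, so the pickups of all trips and scenarios
are postponed together, with a common factor `r`. -/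
theorem isLeast_fullCompactValues_iff (hM : ∀ τ, N.Dominates M τ)
    (hb : BddBelow (N.fullCompactValues M)) (m : ℝ) :
    IsLeast (N.fullCompactValues M) m ↔ IsLeast N.fullSubValuesOnce m := by
  refine isLeast_iff_of_subset_of_dominated (fullSubValuesOnce_subset hM) ?_ m
  rintro m ⟨x, z, c, h1, h2, rfl⟩
  obtain ⟨b, hb⟩ := hb
  choose y δ h3 h4 h5 h6 using fun τ s =>
    (h2 τ s).exists_subFeasible (h1.x_binary τ) fun p => h1.z_binary τ p s
  refine ⟨_, ⟨x, z, y, h1, h3, h4, rfl⟩, ?_⟩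
  have hS := nonneg_of_forall_le_add_mul (b := b)
    (m := ∑ τ, (N.opCost τ.1 * x τ + ∑ s, N.prob s * N.compactObj τ s (c τ s)))
    (S := ∑ τ : N.Trip, ∑ s, N.prob s *
      ∑ p, (N.demand p s : ℝ) * ((N.mu - N.sigma / N.tauDir p) * δ τ s p)) fun r hr => by
    refine hb ⟨x, z, fun τ s => (c τ s).postpone fun p => r * δ τ s p, h1,
      fun τ s => (h2 τ s).postpone fun p => mul_nonneg hr (h5 τ s p), ?_⟩
    simp only [compactObj_postpone]
    rw [Finset.mul_sum, ← Finset.sum_add_distrib]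
    refine Finset.sum_congr rfl fun τ _ => ?_
    rw [add_assoc, Finset.mul_sum, ← Finset.sum_add_distrib]
    exact congrArg _ (Finset.sum_congr rfl fun s _ => by ring)
  simp only [h6, mul_add, Finset.sum_add_distrib] at hS ⊢
  linarith

theorem bddBelow_fullCompactValues (N : MiND Station Line Request Scenario) (M : BigM)
    (hσ : ∀ p, N.sigma ≤ N.mu * N.tauDir p) : BddBelow (N.fullCompactValues M) := by
  choose b hb using fun τ s => N.exists_le_compactObj τ s hσ
  refine ⟨∑ τ : N.Trip, (-|N.opCost τ.1| + ∑ s, N.prob s * b τ s), ?_⟩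
  rintro m ⟨x, z, c, h1, h2, rfl⟩
  refine Finset.sum_le_sum fun τ _ => add_le_add ?_ (Finset.sum_le_sum fun s _ =>
    mul_le_mul_of_nonneg_left (hb τ s _ _ _ _ (h2 τ s)) (N.prob_nonneg s))
  rcases h1.x_binary τ with hx | hx
  · rw [hx, mul_zero]
    exact neg_nonpos.2 (abs_nonneg _)
  · rw [hx, mul_one]
    exact neg_abs_le _

end

end

end MiND

namespace MiND

noncomputable section

open Classical

/-! ### An instance in which the subpath relaxation is strictly tighter -/

/-- A line from `false` to `true` with capacity three, and two requests of two passengers each. -/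
def knapsack : MiND Bool Unit Bool Unit where
  numCk _ := 2
  two_le_numCk _ := le_rfl
  ck _ k := decide (k = 1)
  ck_injective _ := by decide
  dest := true
  ck_last := fun _ k hk => decide_eq_true (Fin.ext (by simp only [Fin.val_one]; omega))
  times _ := {0}
  sched _ _ k := (k : ℕ)
  sched_strictMono _ _ _ := fun _ _ h => Nat.cast_lt.2 h
  sched_nonneg _ _ _ _ := Nat.cast_nonneg _
  lineDist _ _ := 0
  devMax := 0
  ck_near _ _ := le_rfl
  next _ i j := i = false ∧ j = true
  tt _ _ := 1
  tt_pos _ _ _ _ := one_pos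
  K := 0
  -- The capacity is not a multiple of the demand two: fractions of requests can fill the vehicle,
  -- whole requests cannot.
  cap _ := 3
  opCost _ := 0
  fleet := 1
  kappa := 1
  prob _ := 1
  prob_nonneg _ := zero_le_one
  prob_sum := by simp
  demand _ _ := 2
  tDrop _ := 1
  alpha := 0
  tauDir _ := 1
  tauDir_pos _ := one_pos
  walk _ _ := 0
  tauReq _ := 0
  t0 _ _ _ := 0
  walkMax := 0
  waitMax := 1
  -- All weights vanish, so the objective is minus the number of passengers.
  lam := 0
  mu := 0
  sigma := 0
  delta := 0
  lam_nonneg := le_rfl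
  mu_nonneg := le_rfl
  sigma_nonneg := le_rfl
  delta_nonneg := le_rfl
  reward := 1

/-- The trip of the instance. -/
def knapsackTrip : knapsack.Trip := ⟨(), 0, by simp [knapsack]⟩

theorem knapsack_T (k : Fin 2) : knapsack.T knapsackTrip k = (k : ℕ) := rfl

theorem knapsack_Tend : knapsack.Tend knapsackTrip = 1 := by
  exact (knapsack_T 1).trans (by simp)

theorem knapsack_near (i : Bool) : knapsack.Near () i := le_rfl

theorem knapsack_pickupSet (p : Bool) : knapsack.pickupSet knapsackTrip p = Finset.univ := by
  ext i
  simp only [pickupSet, IsPickup, Compatible, knapsack_Tend, Finset.mem_filter, Finset.mem_univ,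
    true_and, iff_true]
  exact ⟨by simp [knapsack], le_rfl, le_rfl⟩

theorem knapsack_succs (i : Bool) : knapsack.succs () i = if i then ∅ else {true} := by
  ext j
  have : knapsack.next () i j ↔ i = false ∧ j = true := Iff.rfl
  cases i <;> simp [succs, this, knapsack_near]

theorem knapsack_preds (i : Bool) : knapsack.preds () i = if i then {false} else ∅ := by
  ext j
  have : knapsack.next () j i ↔ j = false ∧ i = true := Iff.rfl
  cases i <;> simp [preds, this, knapsack_near]

theorem knapsack_unitCost (p i : Bool) (t : ℝ) : knapsack.unitCost knapsackTrip p i t = -1 := by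
  simp [unitCost, knapsack]

/-- The compact solution that picks up the fraction `ω p` of request `p` at the first
checkpoint. -/
def knapsackVars (ω : Bool → ℝ) : knapsack.CompactVars knapsackTrip where
  v _ := 1
  y i j := if i = false ∧ j = true then 1 else 0
  w p i := if i then 0 else ω p
  visitTime i := if i then 1 else 0
  pickTime _ := 0

theorem knapsackVars_out (ω : Bool → ℝ) (i : Bool) :
    (knapsackVars ω).out i = if i then 0 else 1 := by
  have : (knapsackVars ω).out i = ∑ j ∈ knapsack.succs () i, (knapsackVars ω).y i j := rfl
  rw [this, knapsack_succs]
  cases i <;> simp [knapsackVars]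

theorem knapsackVars_inn (ω : Bool → ℝ) (i : Bool) :
    (knapsackVars ω).inn i = if i then 1 else 0 := by
  have : (knapsackVars ω).inn i = ∑ j ∈ knapsack.preds () i, (knapsackVars ω).y j i := rfl
  rw [this, knapsack_preds]
  cases i <;> simp [knapsackVars]

theorem knapsackVars_linear {M : BigM} (hM : M.AtLeast 1) {ω : Bool → ℝ}
    (h1 : ∀ p, ω p ≤ 1) (h2 : 2 * ω false + 2 * ω true ≤ 3) :
    knapsack.CompactLinear knapsackTrip () M 1 (fun _ => 1) (knapsackVars ω) := by
  obtain ⟨hM1, hM2, hM3⟩ := hM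
  have hfirst : knapsack.ck knapsackTrip.1 (knapsack.firstCk knapsackTrip.1) = false := by
    simp [knapsack, firstCk]
  have hlast : knapsack.ck knapsackTrip.1 (knapsack.lastCk knapsackTrip.1) = true := by
    simp [knapsack, lastCk]
  have hw : ∀ p i, (knapsackVars ω).w p i ≤ 1 := fun p i => by
    cases i <;> simp [knapsackVars, h1]
  have hMw : ∀ p i, 1 - (knapsackVars ω).w p i ≤ M.mTravel * (1 - (knapsackVars ω).w p i) :=
    fun p i => le_mul_of_one_le_left (sub_nonneg.2 (hw p i)) hM1
  have hMw0 : ∀ p i, 0 ≤ M.mTravel * (1 - (knapsackVars ω).w p i) :=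
    fun p i => (sub_nonneg.2 (hw p i)).trans (hMw p i)
  have ht : ∀ k : knapsack.Ck knapsackTrip,
      (knapsackVars ω).visitTime (knapsack.ck knapsackTrip.1 k) = knapsack.T knapsackTrip k := by
    have : ∀ k : Fin 2, (if decide (k = 1) = true then (1 : ℝ) else 0) = (k : ℕ) := fun k => by
      fin_cases k <;> simp
    exact this
  exact
    { flow := fun i _ => by
        rw [knapsackVars_out, knapsackVars_inn, hfirst, hlast]
        cases i <;> simp
      travel := fun i _ j hj => by
        have hj' : j ∈ knapsack.succs () i := hj
        rw [knapsack_succs] at hj'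
        cases i
        · obtain rfl : j = true := by simpa using hj'
          simp [knapsackVars, knapsack]
        · simp at hj'
      assigned := fun p _ => by
        rw [knapsack_pickupSet]
        simpa [knapsackVars] using h1 p
      capacity := by
        have hd : ∀ p, knapsack.demand p () = 2 := fun _ => rfl
        have hc : knapsack.cap knapsackTrip.1 = 3 := rfl
        simp only [knapsack_pickupSet, hd, hc]
        simp [knapsackVars]
        linarith
      pickAfterVisit := fun p i _ => by
        have := hMw0 p i
        cases i
        · simpa [knapsackVars] using this
        · simpa [knapsackVars] using hM1
      pickVisited := fun p i _ => by
        rw [knapsackVars_out, knapsackVars_inn]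
        have := hw p i
        cases i <;> simpa using this
      pickEarliest := fun p i _ => by
        have he : knapsack.earliest knapsackTrip p i = 0 := add_zero 0
        have h3 : 0 ≤ (knapsackVars ω).visitTime i := by cases i <;> simp [knapsackVars]
        have := hMw0 p i
        rw [he]
        linarith
      pickLatest := fun p i _ => by
        have he : knapsack.latest knapsackTrip p i = 1 := by simp [latest, knapsack]
        have h3 : (knapsackVars ω).visitTime i ≤ 1 := by cases i <;> simp [knapsackVars]
        have := hMw0 p i
        rw [he]
        linarith
      sched_ge := fun k => by
        have h3 : (knapsackVars ω).v k = 1 := rfl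
        rw [h3, ht k]
        simp
      sched_le := fun k => by
        have h3 : (knapsackVars ω).v k = 1 := rfl
        rw [h3, ht k]
        simp
      stopVisited := fun i _ => by
        rw [knapsackVars_out, knapsackVars_inn]
        cases i
        · simpa [knapsackVars] using zero_le_one.trans hM3
        · simpa [knapsackVars] using hM3
      ckVisited := fun k => by
        rw [knapsackVars_out, knapsackVars_inn]
        refine le_of_eq ?_
        generalize knapsack.ck knapsackTrip.1 k = i
        cases i <;> simp [knapsackVars]
      ckOut := fun k j _ => by
        simp only [knapsackVars]
        split_ifs <;> norm_num
      ckIn := fun k j _ => by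
        simp only [knapsackVars]
        split_ifs <;> norm_num
      skip := fun k _ => by
        have h3 : knapsack.K = 0 := rfl
        simp only [h3, add_zero]
        refine le_trans ?_ (Finset.single_le_sum (fun k' _ => ?_) (Finset.mem_univ k))
        · simp [knapsackVars]
        · simp only [knapsackVars]
          split_ifs <;> norm_num
      visitTime_nonneg := fun i => by cases i <;> simp [knapsackVars]
      pickTime_nonneg := fun p => le_rfl }

theorem knapsack_compactObj (c : knapsack.CompactVars knapsackTrip) :
    knapsack.compactObj knapsackTrip () c =
      -∑ p, ∑ i ∈ knapsack.pickupSet knapsackTrip p, (knapsack.demand p () : ℝ) * c.w p i := by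
  rw [compactObj_eq, ← Finset.sum_neg_distrib]
  refine Finset.sum_congr rfl fun p _ => ?_
  have h : knapsack.mu - knapsack.sigma / knapsack.tauDir p = 0 := by simp [knapsack]
  rw [h, zero_mul, add_zero, ← Finset.mul_sum]
  simp [knapsack_unitCost]

theorem knapsackVars_obj (ω : Bool → ℝ) :
    knapsack.compactObj knapsackTrip () (knapsackVars ω) = -(2 * ω false + 2 * ω true) := by
  have hd : ∀ p, knapsack.demand p () = 2 := fun _ => rfl
  rw [knapsack_compactObj]
  simp only [knapsack_pickupSet, hd]
  simp [knapsackVars]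
  ring

theorem isLeast_knapsack_compact {M : BigM} (hM : M.AtLeast 1) :
    IsLeast (knapsack.compactRelaxedValues knapsackTrip () M 1 fun _ => 1) (-3) := by
  constructor
  · refine ⟨knapsackVars fun _ => 3 / 4, ⟨knapsackVars_linear hM (by norm_num)
      (by norm_num), fun k => ?_, fun i j => ?_, fun p i => ?_⟩, ?_⟩
    · simp [knapsackVars]
    · simp only [knapsackVars]
      split_ifs <;> norm_num
    · simp only [knapsackVars]
      split_ifs <;> norm_num
    · rw [knapsackVars_obj]
      norm_num
  · rintro m ⟨c, hc, rfl⟩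
    rw [knapsack_compactObj, neg_le_neg_iff]
    have h := hc.1.capacity
    rw [mul_one] at h
    exact h.trans (by norm_num [knapsack])

/-- The load of a subpath is even and at most three. -/
theorem knapsack_cost_ge (r : knapsack.Subpath knapsackTrip ()) : -2 ≤ r.cost := by
  have h1 : r.cost = -(r.load : ℝ) := by
    rw [Subpath.cost, Subpath.load, Nat.cast_sum, ← Finset.sum_neg_distrib]
    refine Finset.sum_congr rfl fun p _ => ?_
    cases hp : r.pickup p <;> simp [knapsack_unitCost]
  have h2 : r.load ≤ 3 := r.load_le
  have h3 : r.load ≤ 2 := by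
    have hd : ∀ p, knapsack.demand p () = 2 := fun _ => rfl
    simp only [Subpath.load, hd, Fintype.sum_bool] at h2 ⊢
    split_ifs at h2 ⊢ <;> omega
  rw [h1, neg_le_neg_iff]
  exact_mod_cast h3

theorem isLeast_knapsack_sub :
    IsLeast (knapsack.subRelaxedValues knapsackTrip () 1 fun _ => 1) (-2) := by
  constructor
  · have hc : knapsack.CompactFeasible knapsackTrip () ⟨1, 1, 1⟩ 1 (fun _ => 1)
        (knapsackVars fun p => if p then 0 else 1) := by
      refine ⟨knapsackVars_linear ⟨le_rfl, le_rfl, le_rfl⟩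
        (fun p => by cases p <;> simp) (by norm_num), fun k => Or.inr rfl, fun i j => ?_,
        fun p i => ?_⟩
      · cases i <;> cases j <;> simp [knapsackVars, IsBinary]
      · cases p <;> cases i <;> simp [knapsackVars, IsBinary]
    obtain ⟨y, δ, h1, -, -, h2⟩ := hc.exists_subFeasible (Or.inr rfl) fun _ => Or.inr rfl
    refine ⟨y, h1.relaxed, ?_⟩
    have h : ∀ p, knapsack.mu - knapsack.sigma / knapsack.tauDir p = 0 := by simp [knapsack]
    simp only [h, zero_mul, mul_zero, Finset.sum_const_zero, add_zero] at h2
    rw [← h2, knapsackVars_obj]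
    simp
  · rintro m ⟨y, hy, rfl⟩
    -- Every traveling arc goes from the first to the second checkpoint, so this potential shows
    -- that their total flow is one, and each costs at least `-2`.
    have h1 := hy.1.potential fun n => if n.rank = 0 then 1 else 0
    have h2 : (knapsack.source knapsackTrip).rank = 0 := rfl
    have h3 : (Node.sink : knapsack.Node knapsackTrip).rank ≠ 0 := two_ne_zero
    rw [if_pos h2, if_neg h3, sub_zero, one_mul] at h1
    rw [subObj, weightedSum_eq_sum y _ Arc.cost fun a r => mul_comm _ _]
    have h4 := weightedSum_const_mul y (-2) fun a => (if a.start.rank = 0 then (1 : ℝ) else 0) -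
      if a.finish.rank = 0 then 1 else 0
    rw [h1, mul_one] at h4
    rw [← h4]
    refine weightedSum_mono (fun a => (hy.2 a).1) fun a _ => ?_
    cases a with
    | travel r c c' h =>
      have h5 : (r.u : ℕ) < r.v := r.u_lt_v
      have h6 : (r.v : ℕ) < 2 := r.v.2
      have h7 : (r.u : ℕ) = 0 := by omega
      have h8 : (r.v : ℕ) ≠ 0 := by omega
      simpa [Arc.start, Arc.finish, Node.rank, h7, h8, Arc.cost] using knapsack_cost_ge r
    | terminate c =>
      have h5 : ((knapsack.lastCk knapsackTrip.1 : Fin _) : ℕ) ≠ 0 := one_ne_zero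
      have h6 : knapsack.numCk knapsackTrip.1 ≠ 0 := two_ne_zero
      simp [Arc.start, Arc.finish, Node.rank, h5, h6, Arc.cost]

end

end MiND

/-! ### The proposition -/

theorem proposition1 :
    (∀ (Station : Type u₁) (Line : Type u₂) (Request : Type u₃) (Scenario : Type u₄)
        [Fintype Station] [Fintype Line] [Fintype Request] [Fintype Scenario]
        (N : MiND Station Line Request Scenario),
      ∃ B : ℝ, ∀ M : BigM, M.AtLeast B →
        -- second stage, for each trip and each scenario
        (∀ (τ : N.Trip) (s : Scenario),
          -- binary first-stage decisions: the two formulations are equivalent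
          (∀ (x : ℝ) (z : Request → ℝ), IsBinary x → (∀ p, IsBinary (z p)) →
            (∀ c, N.CompactOptimal τ s M x z c →
              ∃ y, N.SubFeasible τ s x z y ∧ MiND.VisitsOnce y ∧
                N.subObj τ s y = N.compactObj τ s c) ∧
            (∀ y, N.SubFeasible τ s x z y → MiND.VisitsOnce y →
              ∃ c, N.CompactFeasible τ s M x z c ∧ N.compactObj τ s c = N.subObj τ s y) ∧
            (BddBelow (N.compactValues τ s M x z) →
              ∀ m, (IsLeast (N.compactValues τ s M x z) m ↔
                IsLeast (N.subValuesOnce τ s x z) m) ∧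
              (m ∈ N.subValuesOnce τ s x z → IsLeast (N.subValues τ s x z) m →
                IsLeast (N.compactValues τ s M x z) m))) ∧
          -- the linear relaxation of the subpath formulation is at least as tight
          (∀ (x : ℝ) (z : Request → ℝ), 0 ≤ x → x ≤ 1 → (∀ p, 0 ≤ z p ∧ z p ≤ 1) →
            ∀ y, N.SubRelaxed τ s x z y → MiND.VisitsOnce y →
              ∃ c, N.CompactRelaxed τ s M x z c ∧ N.compactObj τ s c = N.subObj τ s y)) ∧
        -- the two-stage models are equivalent
        (BddBelow (N.fullCompactValues M) →
          ∀ m, (IsLeast (N.fullCompactValues M) m ↔ IsLeast N.fullSubValuesOnce m) ∧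
            (m ∈ N.fullSubValuesOnce → IsLeast N.fullSubValues m →
              IsLeast (N.fullCompactValues M) m)) ∧
        -- a sufficient condition for boundedness
        ((∀ p, N.sigma ≤ N.mu * N.tauDir p) →
          BddBelow (N.fullCompactValues M) ∧
          ∀ τ s (x : ℝ) (z : Request → ℝ), BddBelow (N.compactValues τ s M x z))) ∧
    -- the linear relaxation of the subpath formulation can be strictly tighter
    (∃ (Station Line Request Scenario : Type) (_ : Fintype Station) (_ : Fintype Line)
        (_ : Fintype Request) (_ : Fintype Scenario)
        (N : MiND Station Line Request Scenario) (τ : N.Trip) (s : Scenario) (B : ℝ),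
      ∀ M : BigM, M.AtLeast B →
        ∃ a b : ℝ, IsLeast (N.compactRelaxedValues τ s M 1 (fun _ => 1)) a ∧
          IsLeast (N.subRelaxedValues τ s 1 (fun _ => 1)) b ∧ a < b) := by
  refine ⟨?_, ?_⟩
  · intro Station Line Request Scenario _ _ _ _ N
    obtain ⟨B, hB⟩ := N.exists_dominates
    refine ⟨B, fun M hM => ?_⟩
    have hD := hB M hM
    refine ⟨fun τ s => ⟨fun x z hx hz => ⟨fun c hc => hc.exists_sub_eq (hD τ) hx hz,
      fun y hy hs => hy.exists_compactFeasible (hD τ) hx hs, fun hb m => ?_⟩,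
      fun x z hx hx1 _ y hy hs => hy.exists_compactRelaxed (hD τ) hx hx1 hs⟩, fun hb m => ?_,
      fun hσ => ⟨N.bddBelow_fullCompactValues M hσ, fun τ s x z => ?_⟩⟩
    · have h := MiND.isLeast_compactValues_iff (s := s) (hD τ) hx hz hb m
      exact ⟨h, fun h1 h2 => h.2 ⟨h1, fun a ha => h2.2 (MiND.subValuesOnce_subset_subValues ha)⟩⟩
    · have h := MiND.isLeast_fullCompactValues_iff hD hb m
      exact ⟨h, fun h1 h2 => h.2 ⟨h1, fun a ha =>
        h2.2 (MiND.fullSubValuesOnce_subset_fullSubValues ha)⟩⟩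
    · obtain ⟨b, hb⟩ := N.exists_le_compactObj τ s hσ
      refine ⟨b, ?_⟩
      rintro m ⟨c, hc, rfl⟩
      exact hb M x z c hc
  · exact ⟨Bool, Unit, Bool, Unit, inferInstance, inferInstance, inferInstance, inferInstance,
      MiND.knapsack, MiND.knapsackTrip, (), 1, fun M hM => ⟨-3, -2,
      MiND.isLeast_knapsack_compact hM, MiND.isLeast_knapsack_sub, by norm_num⟩⟩
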